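/- **Setting.** Let $X\subset\mathbb R^n$ be compact, $\mu$ a Borel probability measure with $\mu(\mathbb R^n\setminus X)=0$, $y_1,\dots,y_N\in\mathbb R^n$, and let $c(\cdot,y_i)$ be continuous on $X$ for each $i$; put $\|c\|_\infty=\sup_{x\in X,\,i}|c(x,y_i)|$. For $\psi\in\mathbb R^N$ let $\mathrm{Lag}_i(\psi)=\{x\in X: c(x,y_i)+\psi^i=\min_k (c(x,y_k)+\psi^k)\}$ and $\mathcal K^0=\{\psi\in\mathbb R^N:\mu(\mathrm{Lag}_i(\psi))>0\text{ for all }i\}$. Let $\Lambda=\{w\in\mathbb R^N:\sum_i w^i=1,\ w^i\ge 0\}$. Let $F:\mathbb R^N\to\mathbb R\cup\{+\infty\}$ be a proper closed convex function which is $+\infty$ outside $\Lambda$, and suppose that $F$ splits: $F(w)=\sum_i f_i(w^i)+\delta_\Lambda(w)$, where $\delta_\Lambda$ is $0$ on $\Lambda$ and $+\infty$ off $\Lambda$, and each $f_i:\mathbb R\to\mathbb R\cup\{+\infty\}$ is proper, closed and convex with $\mathrm{dom} f_i\subset[0,1]$. Let $F^*(\psi)=\sup_w(\langle w,\psi\rangle-F(w))$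 be the conjugate of $F$. Assume that each $f_i$ is essentially smooth (the interior $C_i$ of $\mathrm{dom} f_i$ is nonempty, $f_i$ is differentiable on $C_i$, and $|f_i'(x_m)|\to\infty$ whenever $x_m\in C_i$ converges to a boundary point of $C_i$), that $f_i$ is twice differentiable on $C_i$ with $f_i''$ locally Lipschitz on $C_i$, and that $f_i''\ge\eta$ on $C_i$ for some $\eta>0$ independent of $i$. **Constants.** Let $a_i=\inf\mathrm{dom} f_i$, $b_i=\sup\mathrm{dom} f_i$, $A=\frac{1-\sum_i a_i}{N}$, $B=\frac{\sum_i b_i-1}{N}$, $$C_1=\max\Big\{0,\ \max_{k:\,a_k+A\in C_k}\big(-f_k'(a_k+A)\big),\ \max_{k:\,b_k-B\in C_k}f_k'(b_k-B)\Big\}+2\|c\|_\infty ,$$ (maxima over an empty set of indices are omitted), and $$S_i=\{x\in C_i:|f_i'(x)|\le C_1\},\qquad C_f=\max_i\ \sup_{x,z\in S_i,\ x\ne z}\frac{|f_i''(x)-f_i''(z)|}{|x-z|}$$ (a supremum over the empty set being $0$). **Theorem.** 1. $F^*$ is finite everywhere, is $C^2$ on $\mathbb R^N$, and is $C^{2,1}$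 on $\mathcal K^0$, i.e. its second derivative is Lipschitz on $\mathcal K^0$. 2. Suppose that $\mathrm{dom} F$ is not a single point. Then for every $\psi\in\mathbb R^N$, with $w=\nabla F^*(\psi)$, one has $w^i\in C_i$ for all $i$, the bordered matrix $$J=\begin{bmatrix} f_1''(w^1)& & &1\\ &\ddots& &\vdots\\ & &f_N''(w^N)&1\\ 1&\cdots&1&0\end{bmatrix}$$ (the Jacobian in $(w,r)$ of $(w,r)\mapsto(f_1'(w^1)+r-\psi^1,\dots,f_N'(w^N)+r-\psi^N,\sum_i w^i-1)$) is invertible, and $D^2F^*(\psi)$ is $J^{-1}$ with its last row and last column removed. 3. Each $S_i$ is a compact subset of $C_i$, $C_f<\infty$, and for all $\psi_1,\psi_2\in\mathcal K^0$ $$\|D^2F^*(\psi_1)-D^2F^*(\psi_2)\|\le 4N^2\,C_f\,\eta^{-3}\,\|\psi_1-\psi_2\|,$$ where the norm on matrices is the Euclidean (Frobenius) norm. -/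

import Mathlib

noncomputable section

namespace SemiDiscrete

/-! ### Extended-real-valued convex functions -/

/-- Effective domain. -/
def effDom {E : Type*} (f : E → EReal) : Set E := {x | f x < ⊤}

/-- Proper: never `-∞` and not identically `+∞`. -/
def IsProper {E : Type*} (f : E → EReal) : Prop :=
  (∀ x, f x ≠ ⊥) ∧ (effDom f).Nonempty

/-- Convexity of an extended-real-valued function: its epigraph is convex. -/
def IsConvexFn {E : Type*} [AddCommGroup E] [Module ℝ E] (f : E → EReal) : Prop :=
  Convex ℝ {p : E × ℝ | f p.1 ≤ (p.2 : EReal)}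

/-- Proper closed (lower semicontinuous) convex function. -/
structure IsProperClosedConvex {E : Type*} [AddCommGroup E] [Module ℝ E] [TopologicalSpace E]
    (f : E → EReal) : Prop where
  proper : IsProper f
  closed : LowerSemicontinuous f
  convex : IsConvexFn f

open Classical in
/-- Convex-analytic indicator: `0` on `A` and `+∞` off `A`. -/
def indicatorFn {E : Type*} (A : Set E) (x : E) : EReal := if x ∈ A then 0 else ⊤

/-- Legendre–Fenchel conjugate `F*(ψ) = sup_w (⟨w, ψ⟩ - F(w))`. -/
def conjugate {N : ℕ} (F : EuclideanSpace ℝ (Fin N) → EReal)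
    (ψ : EuclideanSpace ℝ (Fin N)) : EReal :=
  ⨆ w : EuclideanSpace ℝ (Fin N), (((inner ℝ w ψ : ℝ) : EReal) - F w)

/-- The conjugate as a real-valued function (meaningful where the conjugate is finite). -/
def conjugateReal {N : ℕ} (F : EuclideanSpace ℝ (Fin N) → EReal)
    (ψ : EuclideanSpace ℝ (Fin N)) : ℝ := (conjugate F ψ).toReal

/-! ### Functions of one variable -/

/-- Interior of the effective domain. -/
def intDom (f : ℝ → EReal) : Set ℝ := interior (effDom f)

/-- First derivative of an extended-real-valued function; used on `intDom f` only. -/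
def d1 (f : ℝ → EReal) : ℝ → ℝ := deriv (fun x => (f x).toReal)

/-- Second derivative of an extended-real-valued function; used on `intDom f` only. -/
def d2 (f : ℝ → EReal) : ℝ → ℝ := deriv (d1 f)

/-- Essentially smooth: the interior `C` of the domain is nonempty, `f` is differentiable on `C`,
and `|f'(x_n)| → ∞` along every sequence of `C` that converges to a boundary point of `C`. -/
def IsEssentiallySmooth (f : ℝ → EReal) : Prop :=
  (intDom f).Nonempty ∧
  DifferentiableOn ℝ (fun x => (f x).toReal) (intDom f) ∧
  ∀ (x : ℕ → ℝ) (b : ℝ), (∀ m, x m ∈ intDom f) → b ∈ frontier (intDom f) →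
    Filter.Tendsto x Filter.atTop (nhds b) →
    Filter.Tendsto (fun m => |d1 f (x m)|) Filter.atTop Filter.atTop

/-! ### Storage fee functions -/

/-- The set of admissible weight vectors (the unit simplex). -/
def weightSet (N : ℕ) : Set (EuclideanSpace ℝ (Fin N)) :=
  {w | ∑ i, w i = 1 ∧ ∀ i, 0 ≤ w i}

/-- Storage fee function: proper closed convex, and `+∞` off the simplex. -/
def IsStorageFee {N : ℕ} (F : EuclideanSpace ℝ (Fin N) → EReal) : Prop :=
  IsProperClosedConvex F ∧ ∀ w, w ∉ weightSet N → F w = ⊤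

/-- `F` splits into the functions `f i`. -/
def SplitsInto {N : ℕ} (F : EuclideanSpace ℝ (Fin N) → EReal) (f : Fin N → ℝ → EReal) : Prop :=
  (∀ i, IsProperClosedConvex (f i) ∧ effDom (f i) ⊆ Set.Icc 0 1) ∧
  ∀ w, F w = ∑ i, f i (w i) + indicatorFn (weightSet N) w

/-! ### Laguerre cells -/

/-- The `i`-th Laguerre cell of `ψ`. -/
def laguerreCell {n N : ℕ} (X : Set (EuclideanSpace ℝ (Fin n)))
    (c : EuclideanSpace ℝ (Fin n) → EuclideanSpace ℝ (Fin n) → ℝ)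
    (y : Fin N → EuclideanSpace ℝ (Fin n)) (ψ : EuclideanSpace ℝ (Fin N)) (i : Fin N) :
    Set (EuclideanSpace ℝ (Fin n)) :=
  {x ∈ X | ∀ k, c x (y i) + ψ i ≤ c x (y k) + ψ k}

/-- `K^ε`: the set of `ψ` all of whose Laguerre cells have mass larger than `ε`. -/
def massSet {n N : ℕ} (X : Set (EuclideanSpace ℝ (Fin n)))
    (μ : MeasureTheory.Measure (EuclideanSpace ℝ (Fin n)))
    (c : EuclideanSpace ℝ (Fin n) → EuclideanSpace ℝ (Fin n) → ℝ)
    (y : Fin N → EuclideanSpace ℝ (Fin n)) (ε : ℝ) : Set (EuclideanSpace ℝ (Fin N)) :=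
  {ψ | ∀ i, ε < μ.real (laguerreCell X c y ψ i)}

/-- `‖c‖_∞`, the supremum of `|c(x, y_i)|` over `x ∈ X` and all `i`. -/
def costSup {n N : ℕ} (X : Set (EuclideanSpace ℝ (Fin n)))
    (c : EuclideanSpace ℝ (Fin n) → EuclideanSpace ℝ (Fin n) → ℝ)
    (y : Fin N → EuclideanSpace ℝ (Fin n)) : ℝ :=
  ⨆ p : X × Fin N, |c p.1 (y p.2)|

/-! ### The constants in the Lipschitz estimate -/

/-- Left end point of the domain. -/
def leftEnd (f : ℝ → EReal) : ℝ := sInf (effDom f)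

/-- Right end point of the domain. -/
def rightEnd (f : ℝ → EReal) : ℝ := sSup (effDom f)

/-- `A = (1 - ∑ a_i) / N`. -/
def marginA {N : ℕ} (f : Fin N → ℝ → EReal) : ℝ := (1 - ∑ i, leftEnd (f i)) / N

/-- `B = (∑ b_i - 1) / N`. -/
def marginB {N : ℕ} (f : Fin N → ℝ → EReal) : ℝ := (∑ i, rightEnd (f i) - 1) / N

open Classical in
/-- `C₁ = max (0, max_k (-f_k'(a_k + A)), max_k f_k'(b_k - B)) + 2 ‖c‖_∞`, where an index `k` only
contributes to a maximum if the point in question lies in the interior of the domain of `f_k`.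
The parameter `M` stands for `‖c‖_∞`. -/
def slopeBound {N : ℕ} (f : Fin N → ℝ → EReal) (M : ℝ) : ℝ :=
  max 0 (max
    (⨆ k, if leftEnd (f k) + marginA f ∈ intDom (f k)
      then -d1 (f k) (leftEnd (f k) + marginA f) else 0)
    (⨆ k, if rightEnd (f k) - marginB f ∈ intDom (f k)
      then d1 (f k) (rightEnd (f k) - marginB f) else 0)) + 2 * M

/-- `S_i`: the points of the interior of the domain of `f_i` at which `|f_i'| ≤ C₁`. -/
def slopeSet {N : ℕ} (f : Fin N → ℝ → EReal) (M : ℝ) (i : Fin N) : Set ℝ :=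
  {x ∈ intDom (f i) | |d1 (f i) x| ≤ slopeBound f M}

/-- Difference quotients of `f_i''` on `S_i` (the quotient is `0` for `x = y`). -/
def quotientSet {N : ℕ} (f : Fin N → ℝ → EReal) (M : ℝ) (i : Fin N) : Set ℝ :=
  {q | ∃ x ∈ slopeSet f M i, ∃ z ∈ slopeSet f M i, q = |d2 (f i) x - d2 (f i) z| / |x - z|}

/-- `C_f`, the maximum over `i` of the Lipschitz constant of `f_i''` on `S_i`. -/
def lipConst {N : ℕ} (f : Fin N → ℝ → EReal) (M : ℝ) : ℝ := ⨆ i, sSup (quotientSet f M i)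

/-! ### Second derivatives -/

/-- Hessian matrix. -/
def hessian {N : ℕ} (g : EuclideanSpace ℝ (Fin N) → ℝ) (ψ : EuclideanSpace ℝ (Fin N)) :
    Matrix (Fin N) (Fin N) ℝ :=
  Matrix.of fun i j =>
    fderiv ℝ (fderiv ℝ g) ψ (EuclideanSpace.single i 1) (EuclideanSpace.single j 1)

/-- Euclidean (Frobenius) norm of a matrix. -/
def frobNorm {N : ℕ} (A : Matrix (Fin N) (Fin N) ℝ) : ℝ := Real.sqrt (∑ i, ∑ j, A i j ^ 2)

/-- `g` is `C^{2,1}` on `U`: twice continuously differentiable at the points of `U`, with second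
derivative Lipschitz on `U`. -/
def IsC21On {N : ℕ} (g : EuclideanSpace ℝ (Fin N) → ℝ) (U : Set (EuclideanSpace ℝ (Fin N))) :
    Prop :=
  (∀ ψ ∈ U, ContDiffAt ℝ 2 g ψ) ∧ ∃ K : NNReal, LipschitzOnWith K (fderiv ℝ (fderiv ℝ g)) U

/-- The bordered matrix with diagonal block `diag (f_i''(w^i))`, last row and last column equal to
ones, and corner entry `0`. It is the Jacobian in `(w, r)` of the map
`(w, r) ↦ (f_1'(w^1) + r - ψ^1, …, f_N'(w^N) + r - ψ^N, ∑ w^i - 1)`. -/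
def borderedJacobian {N : ℕ} (f : Fin N → ℝ → EReal) (w : EuclideanSpace ℝ (Fin N)) :
    Matrix (Fin N ⊕ Unit) (Fin N ⊕ Unit) ℝ :=
  Matrix.fromBlocks (Matrix.diagonal fun i => d2 (f i) (w i)) (Matrix.of fun _ _ => 1)
    (Matrix.of fun _ _ => 1) 0

end SemiDiscrete

end

open SemiDiscrete

/-!
A maximizer `w` of `⟨w, ψ⟩ - F(w)` solves, together with the multiplier `r` of the constraint
`∑ w^i = 1`, the system `f_i'(w^i) + r = ψ^i`. By essential smoothness `f_i'` is a bijection from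
`C_i` onto `ℝ`, so the intermediate value theorem in `r` yields a solution, and `w = ∇F*(ψ)`.

Subtracting the systems of `ψ` and `ψ'` gives the exact identity `w' - w = P (ψ' - ψ)`, where `P`
is the inverse, without its last row and column, of the bordered matrix that has on its diagonal the
secant slopes `(f_i'(w'^i) - f_i'(w^i)) / (w'^i - w^i) ≥ η`. Testing this linear system with
`w' - w` shows `‖P‖ ≤ η⁻¹`; letting `ψ'` tend to `ψ` turns `P` into the derivative of `w`, the
Hessian of `F*`. The Hessians `P` and `Q` at two points differ by `P diag(q - p) Q`, with `p` and
`q` the diagonals of the bordered matrices, whence the Lipschitz estimate.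

On `𝒦⁰` the coordinates of `ψ` differ by at most `2 ‖c‖_∞`, hence so do the numbers `f_i'(w^i)`. As
the vectors `a_i + A` and `b_i - B` have the same sum as `w`, some `f_k'(w^k)` is bounded below by
`f_k'(a_k + A)`, and some other one above by `f_k'(b_k - B)`; this confines `w^i` to `S_i`.
-/

namespace SemiDiscrete

open Set Filter Topology

section ConvexFn

variable {E : Type*} {f : E → EReal}

lemma coe_toReal_of_mem_effDom {x : E} (hbot : f x ≠ ⊥) (hx : x ∈ effDom f) :
    (((f x).toReal : ℝ) : EReal) = f x :=
  EReal.coe_toReal (ne_of_lt hx) hbot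

lemma IsConvexFn.convexOn_toReal [AddCommGroup E] [Module ℝ E] (hf : IsConvexFn f)
    (hbot : ∀ x, f x ≠ ⊥) : ConvexOn ℝ (effDom f) fun x => (f x).toReal := by
  have le_combo : ∀ x ∈ effDom f, ∀ z ∈ effDom f, ∀ a b : ℝ, 0 ≤ a → 0 ≤ b → a + b = 1 →
      f (a • x + b • z) ≤ ((a • (f x).toReal + b • (f z).toReal : ℝ) : EReal) :=
    fun x hx z hz a b ha hb hab =>
      hf (x := (x, (f x).toReal)) (coe_toReal_of_mem_effDom (hbot x) hx).ge
        (y := (z, (f z).toReal)) (coe_toReal_of_mem_effDom (hbot z) hz).ge ha hb hab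
  have convex_dom : Convex ℝ (effDom f) := fun x hx z hz a b ha hb hab =>
    (le_combo x hx z hz a b ha hb hab).trans_lt (EReal.coe_lt_top _)
  refine ⟨convex_dom, fun x hx z hz a b ha hb hab => EReal.coe_le_coe_iff.1 ?_⟩
  rw [coe_toReal_of_mem_effDom (hbot _) (convex_dom hx hz ha hb hab)]
  exact le_combo x hx z hz a b ha hb hab

end ConvexFn

section RealLine

variable {s : Set ℝ} {g : ℝ → ℝ}

lemma interior_eq_Ioo_csInf_csSup {α : Type*} [ConditionallyCompleteLinearOrder α]
    [TopologicalSpace α] [OrderTopology α] [DenselyOrdered α] [NoMinOrder α] [NoMaxOrder α]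
    {s : Set α} (hs : IsConnected s) (hb : BddBelow s) (ha : BddAbove s) :
    interior s = Ioo (sInf s) (sSup s) := by
  refine Subset.antisymm ?_ (interior_maximal (hs.Ioo_csInf_csSup_subset hb ha) isOpen_Ioo)
  rw [← interior_Icc]
  exact interior_mono (subset_Icc_csInf_csSup hb ha)

lemma add_deriv_mul_sub_le (hg : ConvexOn ℝ s g) {x z : ℝ} (hx : x ∈ s) (hz : z ∈ s)
    (hd : DifferentiableAt ℝ g x) : g x + deriv g x * (z - x) ≤ g z := by
  rcases lt_trichotomy x z with h | rfl | h
  · have := hg.deriv_le_slope hx hz h hd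
    rw [slope_def_field, le_div_iff₀ (sub_pos.2 h)] at this
    linarith
  · simp
  · have := hg.slope_le_deriv hz hx h hd
    rw [slope_def_field, div_le_iff₀ (sub_pos.2 h)] at this
    linarith

lemma le_dslope_of_le_deriv (hs : Convex ℝ s) (hg : DifferentiableOn ℝ g s) {m : ℝ}
    (hm : ∀ x ∈ s, m ≤ deriv g x) {x z : ℝ} (hx : x ∈ s) (hz : z ∈ s) : m ≤ dslope g x z := by
  have increment := hs.mul_sub_le_image_sub_of_le_deriv hg.continuousOn
    (hg.mono interior_subset) fun u hu => hm u (interior_subset hu)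
  rcases lt_trichotomy x z with h | rfl | h
  · rw [dslope_of_ne _ h.ne', slope_def_field, le_div_iff₀ (sub_pos.2 h)]
    exact increment x hx z hz h.le
  · rw [dslope_same]
    exact hm x hx
  · rw [dslope_of_ne _ h.ne, slope_comm, slope_def_field, le_div_iff₀ (sub_pos.2 h)]
    exact increment z hz x hx h.le

lemma tendsto_atTop_of_tendsto_abs {α : Type*} {l : Filter α} {g : α → ℝ} {K : ℝ}
    (hg : Tendsto (fun x => |g x|) l atTop) (hK : ∀ᶠ x in l, K ≤ g x) : Tendsto g l atTop := by
  refine tendsto_atTop.2 fun u => ?_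
  filter_upwards [hg.eventually_gt_atTop (max |u| |K|), hK] with x hx hKx
  by_contra! hxu
  exact hx.not_ge ((abs_le_max_abs_abs hKx hxu.le).trans_eq (max_comm _ _))

lemma surjOn_Ioo_of_tendsto_abs {a b : ℝ} (hab : a < b) (hmono : MonotoneOn g (Ioo a b))
    (hcont : ContinuousOn g (Ioo a b)) (ha : Tendsto (fun x => |g x|) (𝓝[>] a) atTop)
    (hb : Tendsto (fun x => |g x|) (𝓝[<] b) atTop) : SurjOn g (Ioo a b) univ := by
  obtain ⟨m, hm⟩ := exists_between hab
  refine hcont.surjOn_of_tendsto ⟨m, hm⟩ ((tendsto_comp_coe_Ioo_atBot hab).2 ?_)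
    ((tendsto_comp_coe_Ioo_atTop hab).2 ?_)
  · refine tendsto_neg_atTop_iff.1 (tendsto_atTop_of_tendsto_abs (K := -g m) ?_ ?_)
    · simpa only [abs_neg] using ha
    · filter_upwards [Ioo_mem_nhdsGT hm.1] with x hx
      exact neg_le_neg (hmono ⟨hx.1, hx.2.trans hm.2⟩ hm hx.2.le)
  · refine tendsto_atTop_of_tendsto_abs (K := g m) hb ?_
    filter_upwards [Ioo_mem_nhdsLT hm.2] with x hx
    exact hmono hm ⟨hm.1.trans hx.1, hx.2⟩ hx.1.le

end RealLine

lemma IsEssentiallySmooth.tendsto_abs_d1 {f : ℝ → EReal} (hf : IsEssentiallySmooth f) {b : ℝ}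
    (hb : b ∈ frontier (intDom f)) :
    Tendsto (fun x => |d1 f x|) (𝓝[intDom f] b) atTop := by
  refine tendsto_of_seq_tendsto fun x hx => ?_
  obtain ⟨hxb, hmem⟩ := tendsto_nhdsWithin_iff.1 hx
  obtain ⟨m₀, hm₀⟩ := eventually_atTop.1 hmem
  rw [← tendsto_add_atTop_iff_nat m₀]
  exact hf.2.2 (fun m => x (m + m₀)) b (fun m => hm₀ _ (Nat.le_add_left _ _)) hb
    ((tendsto_add_atTop_iff_nat m₀).2 hxb)

/-- The standing assumptions on one summand of a splitting storage fee, with uniform convexity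
modulus `η`. The domain may be any bounded set of nonnegative numbers. -/
structure IsFeeComponent (f : ℝ → EReal) (η : ℝ) : Prop where
  proper : IsProper f
  convex : IsConvexFn f
  effDom_subset_Ici : effDom f ⊆ Ici 0
  bddAbove_effDom : BddAbove (effDom f)
  essSmooth : IsEssentiallySmooth f
  d1_differentiableOn : DifferentiableOn ℝ (d1 f) (intDom f)
  d2_locallyLipschitzOn : LocallyLipschitzOn (intDom f) (d2 f)
  modulus_pos : 0 < η
  modulus_le_d2 : ∀ x ∈ intDom f, η ≤ d2 f x

/-- The inverse of the derivative of a fee component, which is the derivative of its conjugate. It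
expresses the weights of an optimal `w` through the multiplier of the constraint `∑ i, w i = 1`. -/
noncomputable def slopeInv (f : ℝ → EReal) : ℝ → ℝ := Function.invFunOn (d1 f) (intDom f)

lemma intDom_subset_effDom {f : ℝ → EReal} : intDom f ⊆ effDom f := interior_subset

lemma isOpen_intDom {f : ℝ → EReal} : IsOpen (intDom f) := isOpen_interior

namespace IsFeeComponent

variable {f : ℝ → EReal} {η : ℝ}

lemma bddBelow_effDom (hf : IsFeeComponent f η) : BddBelow (effDom f) :=
  bddBelow_Ici.mono hf.effDom_subset_Ici

lemma convexOn_toReal (hf : IsFeeComponent f η) : ConvexOn ℝ (effDom f) fun x => (f x).toReal :=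
  hf.convex.convexOn_toReal hf.proper.1

lemma intDom_eq_Ioo (hf : IsFeeComponent f η) : intDom f = Ioo (leftEnd f) (rightEnd f) :=
  interior_eq_Ioo_csInf_csSup (hf.convexOn_toReal.1.isConnected hf.proper.2) hf.bddBelow_effDom
    hf.bddAbove_effDom

lemma convex_intDom (hf : IsFeeComponent f η) : Convex ℝ (intDom f) :=
  hf.convexOn_toReal.1.interior

lemma leftEnd_lt_rightEnd (hf : IsFeeComponent f η) : leftEnd f < rightEnd f :=
  nonempty_Ioo.1 (hf.intDom_eq_Ioo ▸ hf.essSmooth.1)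

lemma add_d1_mul_sub_le (hf : IsFeeComponent f η) {x z : ℝ} (hx : x ∈ intDom f)
    (hz : z ∈ effDom f) : (f x).toReal + d1 f x * (z - x) ≤ (f z).toReal :=
  add_deriv_mul_sub_le hf.convexOn_toReal (intDom_subset_effDom hx) hz
    (hf.essSmooth.2.1.differentiableAt (isOpen_intDom.mem_nhds hx))

lemma le_dslope_d1 (hf : IsFeeComponent f η) {x z : ℝ} (hx : x ∈ intDom f)
    (hz : z ∈ intDom f) : η ≤ dslope (d1 f) x z :=
  le_dslope_of_le_deriv hf.convex_intDom hf.d1_differentiableOn hf.modulus_le_d2 hx hz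

lemma strictMonoOn_d1 (hf : IsFeeComponent f η) : StrictMonoOn (d1 f) (intDom f) :=
  strictMonoOn_of_deriv_pos hf.convex_intDom hf.d1_differentiableOn.continuousOn fun x hx =>
    hf.modulus_pos.trans_le (hf.modulus_le_d2 x (interior_subset hx))

lemma surjOn_d1 (hf : IsFeeComponent f η) : SurjOn (d1 f) (intDom f) univ := by
  have hlt := hf.leftEnd_lt_rightEnd
  have blowup {b : ℝ} (hb : b = leftEnd f ∨ b = rightEnd f) :
      Tendsto (fun x => |d1 f x|) (𝓝[Ioo (leftEnd f) (rightEnd f)] b) atTop := by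
    rw [← hf.intDom_eq_Ioo]
    refine hf.essSmooth.tendsto_abs_d1 ?_
    rwa [hf.intDom_eq_Ioo, frontier_Ioo hlt]
  have hmono := hf.strictMonoOn_d1.monotoneOn
  have hcont := hf.d1_differentiableOn.continuousOn
  rw [hf.intDom_eq_Ioo] at hmono hcont ⊢
  refine surjOn_Ioo_of_tendsto_abs hlt hmono hcont ?_ ?_
  · rw [← nhdsWithin_Ioo_eq_nhdsGT hlt]
    exact blowup (.inl rfl)
  · rw [← nhdsWithin_Ioo_eq_nhdsLT hlt]
    exact blowup (.inr rfl)

lemma slopeInv_mem (hf : IsFeeComponent f η) (u : ℝ) : slopeInv f u ∈ intDom f :=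
  Function.invFunOn_mem (hf.surjOn_d1 (mem_univ u))

lemma d1_slopeInv (hf : IsFeeComponent f η) (u : ℝ) : d1 f (slopeInv f u) = u :=
  Function.invFunOn_eq (hf.surjOn_d1 (mem_univ u))

lemma slopeInv_d1 (hf : IsFeeComponent f η) {x : ℝ} (hx : x ∈ intDom f) :
    slopeInv f (d1 f x) = x :=
  hf.strictMonoOn_d1.injOn (hf.slopeInv_mem _) hx (hf.d1_slopeInv _)

lemma monotone_slopeInv (hf : IsFeeComponent f η) : Monotone (slopeInv f) := fun u v huv => by
  rwa [← hf.strictMonoOn_d1.le_iff_le (hf.slopeInv_mem u) (hf.slopeInv_mem v), hf.d1_slopeInv,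
    hf.d1_slopeInv]

lemma lipschitzWith_slopeInv (hf : IsFeeComponent f η) :
    LipschitzWith (Real.toNNReal η⁻¹) (slopeInv f) := by
  refine LipschitzWith.of_dist_le_mul fun u v => ?_
  have hslope := hf.le_dslope_d1 (hf.slopeInv_mem v) (hf.slopeInv_mem u)
  have hsub := sub_smul_dslope (d1 f) (slopeInv f v) (slopeInv f u)
  rw [hf.d1_slopeInv, hf.d1_slopeInv, smul_eq_mul] at hsub
  rw [Real.coe_toNNReal _ (inv_nonneg.2 hf.modulus_pos.le), inv_mul_eq_div,
    le_div_iff₀ hf.modulus_pos, Real.dist_eq, Real.dist_eq, ← hsub, abs_mul]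
  exact mul_le_mul_of_nonneg_left (hslope.trans (le_abs_self _)) (abs_nonneg _)

lemma setOf_abs_d1_le_eq_image (hf : IsFeeComponent f η) (K : ℝ) :
    {x ∈ intDom f | |d1 f x| ≤ K} = slopeInv f '' Icc (-K) K := by
  ext x
  constructor
  · rintro ⟨hx, hK⟩
    exact ⟨d1 f x, abs_le.1 hK, hf.slopeInv_d1 hx⟩
  · rintro ⟨u, hu, rfl⟩
    exact ⟨hf.slopeInv_mem u, (hf.d1_slopeInv u).symm ▸ abs_le.2 hu⟩

lemma isCompact_setOf_abs_d1_le (hf : IsFeeComponent f η) (K : ℝ) :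
    IsCompact {x ∈ intDom f | |d1 f x| ≤ K} :=
  hf.setOf_abs_d1_le_eq_image K ▸ isCompact_Icc.image hf.lipschitzWith_slopeInv.continuous

end IsFeeComponent

section CurvatureLipschitz

variable {N : ℕ} {f : Fin N → ℝ → EReal} {η : ℝ}

lemma bddAbove_quotientSet {M : ℝ} {i : Fin N} (hf : IsFeeComponent (f i) η) :
    BddAbove (quotientSet f M i) := by
  obtain ⟨K, hK⟩ := (hf.d2_locallyLipschitzOn.mono (fun _ hx => hx.1 :
    slopeSet f M i ⊆ _)).exists_lipschitzOnWith_of_compact (hf.isCompact_setOf_abs_d1_le _)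
  refine ⟨K, ?_⟩
  rintro q ⟨x, hx, z, hz, rfl⟩
  exact div_le_of_le_mul₀ (abs_nonneg _) K.2 (hK.dist_le_mul x hx z hz)

lemma lipConst_nonneg (f : Fin N → ℝ → EReal) (M : ℝ) : 0 ≤ lipConst f M := by
  refine Real.iSup_nonneg fun i => Real.sSup_nonneg ?_
  rintro q ⟨x, -, z, -, rfl⟩
  positivity

lemma abs_d2_sub_le {M : ℝ} {i : Fin N} (hf : IsFeeComponent (f i) η) {x z : ℝ}
    (hx : x ∈ slopeSet f M i) (hz : z ∈ slopeSet f M i) :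
    |d2 (f i) x - d2 (f i) z| ≤ lipConst f M * |x - z| := by
  rcases eq_or_ne x z with rfl | hne
  · simp
  rw [← div_le_iff₀ (abs_pos.2 (sub_ne_zero.2 hne))]
  exact (le_csSup (bddAbove_quotientSet hf) ⟨x, hx, z, hz, rfl⟩).trans
    (le_ciSup (f := fun i => sSup (quotientSet f M i)) (Set.finite_range _).bddAbove i)

end CurvatureLipschitz

section BorderedDiagonal

open Matrix

/-- The diagonal matrix `diagonal d` bordered by a row and a column of ones with corner entry `0`:
the matrix of the system `d i * u i + s = v i`, `∑ i, u i = 0` in the unknowns `u` and `s`. -/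
def borderedDiag {ι R : Type*} [DecidableEq ι] [Zero R] [One R] (d : ι → R) :
    Matrix (ι ⊕ Unit) (ι ⊕ Unit) R :=
  fromBlocks (diagonal d) (of fun _ _ => 1) (of fun _ _ => 1) 0

/-- The inverse of `borderedDiag d` with its last row and last column removed. It maps `v` to the
solution `u` of the bordered system, the unknown `s` being eliminated. -/
noncomputable def condensedInv {ι R : Type*} [Fintype ι] [DecidableEq ι] [CommRing R]
    (d : ι → R) : Matrix ι ι R :=
  ((borderedDiag d)⁻¹).toBlocks₁₁

lemma toBlocks₁₁_mulVec {ι κ R : Type*} [Fintype ι] [Fintype κ] [NonUnitalNonAssocSemiring R]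
    (A : Matrix (ι ⊕ κ) (ι ⊕ κ) R) (v : ι → R) (i : ι) :
    (A.toBlocks₁₁ *ᵥ v) i = (A *ᵥ Sum.elim v fun _ => 0) (.inl i) := by
  simp [mulVec, dotProduct, toBlocks₁₁]

lemma mul_norm_le_of_bordered {ι : Type*} [Fintype ι] {η s : ℝ} {d : ι → ℝ} (hd : ∀ i, η ≤ d i)
    {u v : EuclideanSpace ℝ ι} (hsum : ∑ i, u i = 0) (hs : ∀ i, d i * u i + s = v i) :
    η * ‖u‖ ≤ ‖v‖ := by
  have energy : η * ‖u‖ ^ 2 ≤ ‖v‖ * ‖u‖ := calc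
    η * ‖u‖ ^ 2 = ∑ i, η * u i ^ 2 := by
      rw [EuclideanSpace.real_norm_sq_eq, Finset.mul_sum]
    _ ≤ ∑ i, d i * u i ^ 2 := by
      gcongr with i
      exact hd i
    _ = ∑ i, v i * u i - s * ∑ i, u i := by
      rw [Finset.mul_sum, ← Finset.sum_sub_distrib]
      exact Finset.sum_congr rfl fun i _ => by linear_combination u i * hs i
    _ = inner ℝ u v := by
      rw [hsum, mul_zero, sub_zero]
      simp only [PiLp.inner_apply, RCLike.inner_apply, conj_trivial]
    _ ≤ ‖v‖ * ‖u‖ := (real_inner_le_norm u v).trans_eq (mul_comm _ _)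
  rcases (norm_nonneg u).eq_or_lt with hu | hu
  · rw [← hu, mul_zero]
    exact norm_nonneg v
  · exact le_of_mul_le_mul_right (by linarith) hu

variable {ι : Type*} [Fintype ι] [DecidableEq ι]

section CommRing

variable {R : Type*} [CommRing R] {d e : ι → R}

lemma borderedDiag_mulVec (d u : ι → R) (s : R) :
    borderedDiag d *ᵥ Sum.elim u (fun _ => s) =
      Sum.elim (fun i => d i * u i + s) (fun _ => ∑ i, u i) := by
  ext (i | i) <;>
    simp [borderedDiag, mulVec, dotProduct, diagonal_apply]

lemma condensedInv_mulVec_eq_iff (hd : IsUnit (borderedDiag d)) {u v : ι → R} :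
    condensedInv d *ᵥ v = u ↔ ∑ i, u i = 0 ∧ ∃ s, ∀ i, d i * u i + s = v i := by
  rw [isUnit_iff_isUnit_det] at hd
  constructor
  · rintro rfl
    set x := (borderedDiag d)⁻¹ *ᵥ Sum.elim v fun _ => 0 with hx
    have hsplit : x = Sum.elim (condensedInv d *ᵥ v) fun _ => x (.inr ()) := by
      ext (i | i)
      · exact (toBlocks₁₁_mulVec _ _ _).symm
      · rfl
    have hsolve : borderedDiag d *ᵥ x = Sum.elim v fun _ => 0 := by
      rw [hx, mulVec_mulVec, mul_nonsing_inv _ hd, one_mulVec]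
    rw [hsplit, borderedDiag_mulVec] at hsolve
    exact ⟨congrFun hsolve (.inr ()), _, fun i => congrFun hsolve (.inl i)⟩
  · rintro ⟨hsum, s, hs⟩
    have hsolve : borderedDiag d *ᵥ Sum.elim u (fun _ => s) = Sum.elim v fun _ => 0 := by
      rw [borderedDiag_mulVec, funext hs, hsum]
    ext i
    rw [condensedInv, toBlocks₁₁_mulVec, ← hsolve, mulVec_mulVec, nonsing_inv_mul _ hd,
      one_mulVec, Sum.elim_inl]

lemma isSymm_condensedInv (d : ι → R) : (condensedInv d).IsSymm := by
  have hsymm : (borderedDiag d).IsSymm := by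
    rw [IsSymm, borderedDiag, fromBlocks_transpose, diagonal_transpose, transpose_zero]
    rfl
  exact IsSymm.ext fun i j => hsymm.inv.apply (.inl i) (.inl j)

lemma condensedInv_sub_condensedInv (hd : IsUnit (borderedDiag d))
    (he : IsUnit (borderedDiag e)) :
    condensedInv d - condensedInv e = condensedInv d * diagonal (e - d) * condensedInv e := by
  refine ext_of_mulVec_single fun j => ?_
  set v : ι → R := Pi.single j 1
  obtain ⟨hx_sum, s, hx⟩ := (condensedInv_mulVec_eq_iff he (v := v)).1 rfl
  set x := condensedInv e *ᵥ v
  obtain ⟨hy_sum, t, hy⟩ :=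
    (condensedInv_mulVec_eq_iff hd (v := diagonal (e - d) *ᵥ x)).1 rfl
  set y := condensedInv d *ᵥ diagonal (e - d) *ᵥ x
  have hxy : condensedInv d *ᵥ v = x + y := by
    refine (condensedInv_mulVec_eq_iff hd).2 ⟨?_, s + t, fun i => ?_⟩
    · simp only [Pi.add_apply, Finset.sum_add_distrib, hx_sum, hy_sum, add_zero]
    · have hy := hy i
      rw [mulVec_diagonal, Pi.sub_apply] at hy
      rw [Pi.add_apply, ← hx i]
      linear_combination hy
  rw [sub_mulVec, hxy, add_sub_cancel_left, ← mulVec_mulVec, ← mulVec_mulVec]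

end CommRing

lemma isUnit_borderedDiag [Nonempty ι] {K : Type*} [Field K] [LinearOrder K]
    [IsStrictOrderedRing K] {d : ι → K} (hd : ∀ i, 0 < d i) : IsUnit (borderedDiag d) := by
  refine mulVec_injective_iff_isUnit.1 ((injective_iff_map_eq_zero (mulVecLin _)).2 fun x hx => ?_)
  obtain ⟨u, s, rfl⟩ : ∃ u s, x = Sum.elim u fun _ => s :=
    ⟨x ∘ .inl, x (.inr ()), by ext (i | i) <;> rfl⟩
  rw [mulVecLin_apply, borderedDiag_mulVec] at hx
  have hu_sum : ∑ i, u i = 0 := congrFun hx (.inr ())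
  have hus : ∀ i, d i * u i + s = 0 := fun i => congrFun hx (.inl i)
  have energy : ∑ i, d i * u i ^ 2 = 0 := calc
    ∑ i, d i * u i ^ 2 = ∑ i, -s * u i :=
      Finset.sum_congr rfl fun i _ => by linear_combination u i * hus i
    _ = 0 := by rw [← Finset.mul_sum, hu_sum, mul_zero]
  have hu : ∀ i, u i = 0 := fun i => by
    have hterm := (Finset.sum_eq_zero_iff_of_nonneg fun i _ =>
      mul_nonneg (hd i).le (sq_nonneg (u i))).1 energy i (Finset.mem_univ i)
    exact pow_eq_zero_iff two_ne_zero |>.1 ((mul_eq_zero_iff_left (hd i).ne').1 hterm)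
  obtain ⟨i⟩ := ‹Nonempty ι›
  have hs : s = 0 := by simpa only [hu i, mul_zero, zero_add] using hus i
  ext (j | _)
  · exact hu j
  · exact hs

lemma continuousAt_condensedInv {K : Type*} [Field K] [TopologicalSpace K] [IsTopologicalRing K]
    [ContinuousInv₀ K] {d : ι → K} (hd : IsUnit (borderedDiag d)) :
    ContinuousAt condensedInv d := by
  have hdet : (borderedDiag d).det ≠ 0 := ((isUnit_iff_isUnit_det _).1 hd).ne_zero
  have hinv : ContinuousAt (Inv.inv : Matrix (ι ⊕ Unit) (ι ⊕ Unit) K → _) (borderedDiag d) := by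
    refine continuousAt_matrix_inv _ ?_
    rw [Ring.inverse_eq_inv']
    exact continuousAt_inv₀ hdet
  have hbordered : Continuous (borderedDiag : (ι → K) → _) :=
    (continuous_id.matrix_diagonal).matrix_fromBlocks continuous_const continuous_const
      continuous_const
  have hblock : Continuous (toBlocks₁₁ : Matrix (ι ⊕ Unit) (ι ⊕ Unit) K → _) :=
    continuous_id.matrix_submatrix _ _
  exact hblock.continuousAt.comp (hinv.comp (f := borderedDiag) hbordered.continuousAt)

lemma norm_toEuclideanCLM_condensedInv_le [Nonempty ι] {η : ℝ} (hη : 0 < η) {d : ι → ℝ}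
    (hd : ∀ i, η ≤ d i) : ‖toEuclideanCLM (𝕜 := ℝ) (condensedInv d)‖ ≤ η⁻¹ := by
  refine ContinuousLinearMap.opNorm_le_bound _ (inv_nonneg.2 hη.le) fun v => ?_
  have hunit := isUnit_borderedDiag fun i => hη.trans_le (hd i)
  obtain ⟨hsum, s, hs⟩ := (condensedInv_mulVec_eq_iff hunit (v := v.ofLp)).1 rfl
  rw [inv_mul_eq_div, le_div_iff₀' hη]
  exact mul_norm_le_of_bordered hd hsum hs

end BorderedDiagonal

section Frobenius

open Matrix

variable {N : ℕ}

lemma frobNorm_nonneg (A : Matrix (Fin N) (Fin N) ℝ) : 0 ≤ frobNorm A := Real.sqrt_nonneg _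

lemma frobNorm_sq (A : Matrix (Fin N) (Fin N) ℝ) : frobNorm A ^ 2 = ∑ i, ∑ j, A i j ^ 2 :=
  Real.sq_sqrt (by positivity)

lemma frobNorm_sq_eq_sum_col (A : Matrix (Fin N) (Fin N) ℝ) :
    frobNorm A ^ 2 = ∑ j, ‖WithLp.toLp 2 (A.col j)‖ ^ 2 := by
  rw [frobNorm_sq, Finset.sum_comm]
  simp only [EuclideanSpace.real_norm_sq_eq, col_apply]

lemma frobNorm_transpose (A : Matrix (Fin N) (Fin N) ℝ) : frobNorm Aᵀ = frobNorm A := by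
  rw [frobNorm, Finset.sum_comm]
  rfl

lemma frobNorm_diagonal (x : Fin N → ℝ) : frobNorm (diagonal x) = ‖WithLp.toLp 2 x‖ := by
  rw [← sq_eq_sq₀ (frobNorm_nonneg _) (norm_nonneg _), frobNorm_sq,
    EuclideanSpace.real_norm_sq_eq]
  refine Finset.sum_congr rfl fun i _ => ?_
  simp [diagonal_apply]

lemma frobNorm_mul_le_norm_mul_frobNorm (A B : Matrix (Fin N) (Fin N) ℝ) :
    frobNorm (A * B) ≤ ‖toEuclideanCLM (𝕜 := ℝ) A‖ * frobNorm B := by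
  rw [← sq_le_sq₀ (frobNorm_nonneg _) (mul_nonneg (norm_nonneg _) (frobNorm_nonneg _)), mul_pow,
    frobNorm_sq_eq_sum_col, frobNorm_sq_eq_sum_col, Finset.mul_sum]
  refine Finset.sum_le_sum fun j _ => ?_
  rw [← mul_pow]
  gcongr
  exact (toEuclideanCLM (𝕜 := ℝ) A).le_opNorm (WithLp.toLp 2 (B.col j))

lemma frobNorm_mul_le_frobNorm_mul_norm (A B : Matrix (Fin N) (Fin N) ℝ) :
    frobNorm (A * B) ≤ frobNorm A * ‖toEuclideanCLM (𝕜 := ℝ) B‖ := calc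
  frobNorm (A * B) = frobNorm (Bᵀ * Aᵀ) := by rw [← transpose_mul, frobNorm_transpose]
  _ ≤ ‖toEuclideanCLM (𝕜 := ℝ) Bᵀ‖ * frobNorm Aᵀ := frobNorm_mul_le_norm_mul_frobNorm _ _
  _ = frobNorm A * ‖toEuclideanCLM (𝕜 := ℝ) B‖ := by
    rw [frobNorm_transpose, mul_comm, ← conjTranspose_eq_transpose_of_trivial,
      ← star_eq_conjTranspose, map_star,
      ContinuousLinearMap.star_eq_adjoint, LinearIsometryEquiv.norm_map]

lemma norm_toEuclideanCLM_le_frobNorm (A : Matrix (Fin N) (Fin N) ℝ) :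
    ‖toEuclideanCLM (𝕜 := ℝ) A‖ ≤ frobNorm A := by
  refine ContinuousLinearMap.opNorm_le_bound _ (frobNorm_nonneg A) fun v => ?_
  rw [← sq_le_sq₀ (norm_nonneg _) (mul_nonneg (frobNorm_nonneg _) (norm_nonneg _)), mul_pow,
    frobNorm_sq, EuclideanSpace.real_norm_sq_eq, EuclideanSpace.real_norm_sq_eq, Finset.sum_mul]
  exact Finset.sum_le_sum fun i _ => Finset.sum_mul_sq_le_sq_mul_sq Finset.univ (A i) v

lemma norm_le_frobNorm_of_bilin
    (B : EuclideanSpace ℝ (Fin N) →L[ℝ] EuclideanSpace ℝ (Fin N) →L[ℝ] ℝ) :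
    ‖B‖ ≤ frobNorm (of fun i j => B (EuclideanSpace.single i 1) (EuclideanSpace.single j 1)) := by
  set A : Matrix (Fin N) (Fin N) ℝ :=
    of fun i j => B (EuclideanSpace.single i 1) (EuclideanSpace.single j 1) with hA
  have expand (x : EuclideanSpace ℝ (Fin N)) : x = ∑ i, x i • EuclideanSpace.single i 1 := by
    simpa using ((EuclideanSpace.basisFun (Fin N) ℝ).sum_repr x).symm
  have hB (x y) : B x y = inner ℝ x (toEuclideanCLM (𝕜 := ℝ) A y) := by
    rw [inner_toEuclideanCLM, hA]
    conv_lhs => rw [expand x, expand y]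
    simp only [map_sum, map_smul, _root_.sum_apply, _root_.smul_apply, smul_eq_mul, dotProduct,
      mulVec, of_apply, Finset.mul_sum]
    rw [Finset.sum_comm]
    exact Finset.sum_congr rfl fun i _ => Finset.sum_congr rfl fun j _ => by ring
  refine B.opNorm_le_bound₂ (frobNorm_nonneg A) fun x y => ?_
  rw [hB]
  calc ‖inner ℝ x (toEuclideanCLM (𝕜 := ℝ) A y)‖
      ≤ ‖x‖ * (‖toEuclideanCLM (𝕜 := ℝ) A‖ * ‖y‖) :=
        (norm_inner_le_norm _ _).trans (by gcongr; exact ContinuousLinearMap.le_opNorm _ _)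
    _ ≤ ‖x‖ * (frobNorm A * ‖y‖) := by
      gcongr
      exact norm_toEuclideanCLM_le_frobNorm A
    _ = frobNorm A * ‖x‖ * ‖y‖ := by ring

lemma frobNorm_condensedInv_sub_le {η : ℝ} (hη : 0 < η) {d e : Fin N → ℝ} (hd : ∀ i, η ≤ d i)
    (he : ∀ i, η ≤ e i) :
    frobNorm (condensedInv d - condensedInv e) ≤ η⁻¹ ^ 2 * ‖WithLp.toLp 2 (d - e)‖ := by
  rcases isEmpty_or_nonempty (Fin N) with hN | hN
  · rw [Subsingleton.elim d e, sub_self, sub_self]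
    simp [frobNorm]
  rw [condensedInv_sub_condensedInv (isUnit_borderedDiag fun i => hη.trans_le (hd i))
    (isUnit_borderedDiag fun i => hη.trans_le (he i))]
  calc frobNorm (condensedInv d * diagonal (e - d) * condensedInv e)
      ≤ ‖toEuclideanCLM (𝕜 := ℝ) (condensedInv d)‖ * frobNorm (diagonal (e - d)) *
        ‖toEuclideanCLM (𝕜 := ℝ) (condensedInv e)‖ :=
        (frobNorm_mul_le_frobNorm_mul_norm _ _).trans (mul_le_mul_of_nonneg_right
          (frobNorm_mul_le_norm_mul_frobNorm _ _) (norm_nonneg _))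
    _ ≤ η⁻¹ * ‖WithLp.toLp 2 (d - e)‖ * η⁻¹ := by
      rw [frobNorm_diagonal, ← neg_sub d e, WithLp.toLp_neg, norm_neg]
      gcongr
      · exact norm_toEuclideanCLM_condensedInv_le hη hd
      · exact norm_toEuclideanCLM_condensedInv_le hη he
    _ = η⁻¹ ^ 2 * ‖WithLp.toLp 2 (d - e)‖ := by ring

end Frobenius

section Calculus

lemma hasFDerivAt_of_sub_eq_apply_sub {𝕜 E F : Type*} [NontriviallyNormedField 𝕜]
    [NormedAddCommGroup E] [NormedSpace 𝕜 E] [NormedAddCommGroup F] [NormedSpace 𝕜 F] {g : E → F}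
    {L : E → E →L[𝕜] F} {x : E} (hL : ContinuousAt L x) (h : ∀ z, g z - g x = L z (z - x)) :
    HasFDerivAt g (L x) x := by
  rw [hasFDerivAt_iff_isLittleO, Asymptotics.isLittleO_iff]
  intro ε hε
  filter_upwards [Metric.continuousAt_iff'.1 hL ε hε] with z hz
  rw [h, ← _root_.sub_apply]
  rw [dist_eq_norm] at hz
  exact (ContinuousLinearMap.le_opNorm _ _).trans (by gcongr)

section InnerProductSpace

variable {E : Type*} [NormedAddCommGroup E] [InnerProductSpace ℝ E]
  {g : E → ℝ} {p : E → E}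

lemma hasGradientAt_of_subgradient [CompleteSpace E] {x : E} (hp : ContinuousAt p x)
    (hsub : ∀ y z, g y + inner ℝ (p y) (z - y) ≤ g z) : HasGradientAt g (p x) x := by
  rw [hasGradientAt_iff_isLittleO, Asymptotics.isLittleO_iff]
  intro ε hε
  filter_upwards [Metric.continuousAt_iff'.1 hp ε hε] with z hz
  have lower : 0 ≤ g z - g x - inner ℝ (p x) (z - x) := by linarith [hsub x z]
  have upper : g z - g x - inner ℝ (p x) (z - x) ≤ inner ℝ (p z - p x) (z - x) := by
    have := hsub z x
    rw [← neg_sub z x, inner_neg_right] at this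
    rw [inner_sub_left]
    linarith
  rw [Real.norm_of_nonneg lower]
  rw [dist_eq_norm] at hz
  exact upper.trans ((real_inner_le_norm _ _).trans (by gcongr))

lemma fderiv_eq_innerSL_comp [CompleteSpace E] (hg : ∀ x, HasGradientAt g (p x) x) :
    fderiv ℝ g = fun x => innerSL ℝ (p x) :=
  funext fun x => (hg x).hasFDerivAt.fderiv

lemma contDiff_two_of_hasGradientAt [CompleteSpace E] (hg : ∀ x, HasGradientAt g (p x) x)
    (hp : ContDiff ℝ 1 p) : ContDiff ℝ 2 g :=
  (contDiff_succ_iff_hasFDerivAt (n := 1)).2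
    ⟨_, (innerSL ℝ).contDiff.comp hp, fun x => (hg x).hasFDerivAt⟩

end InnerProductSpace

section Hessian

open Matrix

variable {N : ℕ} {g : EuclideanSpace ℝ (Fin N) → ℝ}

lemma hessian_eq_transpose {p : EuclideanSpace ℝ (Fin N) → EuclideanSpace ℝ (Fin N)}
    {A : Matrix (Fin N) (Fin N) ℝ} {ψ : EuclideanSpace ℝ (Fin N)}
    (hg : ∀ x, HasGradientAt g (p x) x)
    (hp : HasFDerivAt p (toEuclideanCLM (𝕜 := ℝ) A) ψ) : hessian g ψ = Aᵀ := by
  have hderiv : HasFDerivAt (fderiv ℝ g) ((innerSL ℝ).comp (toEuclideanCLM (𝕜 := ℝ) A)) ψ :=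
    fderiv_eq_innerSL_comp hg ▸ (innerSL ℝ).hasFDerivAt.comp ψ hp
  ext i j
  simp [hessian, hderiv.fderiv, EuclideanSpace.inner_single_right]

lemma IsC21On.mono {U V : Set (EuclideanSpace ℝ (Fin N))} (hg : IsC21On g V) (hUV : U ⊆ V) :
    IsC21On g U :=
  ⟨fun ψ hψ => hg.1 ψ (hUV hψ), hg.2.imp fun _ hK => hK.mono hUV⟩

lemma isC21On_of_frobNorm_hessian_sub_le {U : Set (EuclideanSpace ℝ (Fin N))} {K : ℝ}
    (hg : ContDiff ℝ 2 g) (hK : ∀ ψ₁ ∈ U, ∀ ψ₂ ∈ U,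
      frobNorm (hessian g ψ₁ - hessian g ψ₂) ≤ K * ‖ψ₁ - ψ₂‖) : IsC21On g U := by
  refine ⟨fun ψ _ => hg.contDiffAt, K.toNNReal, LipschitzOnWith.of_dist_le_mul ?_⟩
  intro ψ₁ hψ₁ ψ₂ hψ₂
  rw [dist_eq_norm, dist_eq_norm]
  calc ‖fderiv ℝ (fderiv ℝ g) ψ₁ - fderiv ℝ (fderiv ℝ g) ψ₂‖
      ≤ frobNorm (hessian g ψ₁ - hessian g ψ₂) := norm_le_frobNorm_of_bilin _
    _ ≤ K * ‖ψ₁ - ψ₂‖ := hK ψ₁ hψ₁ ψ₂ hψ₂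
    _ ≤ K.toNNReal * ‖ψ₁ - ψ₂‖ := by
      gcongr
      exact Real.le_coe_toNNReal K

end Hessian

end Calculus

section KKT

open Matrix

/-- The optimality system for maximizing `⟨w, ψ⟩ - ∑ i, f i (w i)` subject to `∑ i, w i = 1`, with
Lagrange multiplier `r`. -/
structure IsKKTPoint {ι : Type*} [Fintype ι] (f : ι → ℝ → EReal) (ψ w : EuclideanSpace ℝ ι)
    (r : ℝ) : Prop where
  mem_intDom : ∀ i, w i ∈ intDom (f i)
  d1_add : ∀ i, d1 (f i) (w i) + r = ψ i
  sum_eq_one : ∑ i, w i = 1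

variable {ι : Type*} [Fintype ι] {f : ι → ℝ → EReal} {η : ℝ}

lemma nonempty_of_sum_eq_one {w : ι → ℝ} (hw : ∑ i, w i = 1) : Nonempty ι := by
  by_contra hι
  rw [not_nonempty_iff] at hι
  simp at hw

section Secant

variable {ψ ψ' w w' : EuclideanSpace ℝ ι} {r r' : ℝ}

lemma IsKKTPoint.condensedInv_dslope_apply [DecidableEq ι] (hf : ∀ i, IsFeeComponent (f i) η)
    (hw : IsKKTPoint f ψ w r) (hw' : IsKKTPoint f ψ' w' r') :
    toEuclideanCLM (𝕜 := ℝ) (condensedInv fun i => dslope (d1 (f i)) (w i) (w' i)) (ψ' - ψ) =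
      w' - w := by
  have := nonempty_of_sum_eq_one hw.sum_eq_one
  have hunit : IsUnit (borderedDiag fun i => dslope (d1 (f i)) (w i) (w' i)) :=
    isUnit_borderedDiag fun i =>
      (hf i).modulus_pos.trans_le ((hf i).le_dslope_d1 (hw.mem_intDom i) (hw'.mem_intDom i))
  refine WithLp.ofLp_injective 2 ((condensedInv_mulVec_eq_iff hunit).2 ⟨?_, r' - r, fun i => ?_⟩)
  · simp [hw.sum_eq_one, hw'.sum_eq_one]
  · have secant := sub_smul_dslope (d1 (f i)) (w i) (w' i)
    rw [smul_eq_mul] at secant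
    change _ * (w' i - w i) + (r' - r) = ψ' i - ψ i
    linear_combination secant + hw'.d1_add i - hw.d1_add i

lemma IsKKTPoint.norm_sub_le (hf : ∀ i, IsFeeComponent (f i) η)
    (hw : IsKKTPoint f ψ w r) (hw' : IsKKTPoint f ψ' w' r') :
    ‖w' - w‖ ≤ η⁻¹ * ‖ψ' - ψ‖ := by
  classical
  have hι := nonempty_of_sum_eq_one hw.sum_eq_one
  rw [← hw.condensedInv_dslope_apply hf hw']
  exact ContinuousLinearMap.le_of_opNorm_le _ (norm_toEuclideanCLM_condensedInv_le
    (hf hι.some).modulus_pos fun i =>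
      (hf i).le_dslope_d1 (hw.mem_intDom i) (hw'.mem_intDom i)) _

end Secant

section Selection

variable {w : EuclideanSpace ℝ ι → EuclideanSpace ℝ ι} {r : EuclideanSpace ℝ ι → ℝ}

lemma continuous_of_isKKTPoint (hf : ∀ i, IsFeeComponent (f i) η)
    (hw : ∀ ψ, IsKKTPoint f ψ (w ψ) (r ψ)) : Continuous w :=
  (LipschitzWith.of_dist_le' fun ψ' ψ => by
    rw [dist_eq_norm, dist_eq_norm]
    exact (hw ψ).norm_sub_le hf (hw ψ')).continuous

lemma isUnit_borderedDiag_d2 [DecidableEq ι] (hf : ∀ i, IsFeeComponent (f i) η)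
    {ψ u : EuclideanSpace ℝ ι} {s : ℝ} (hu : IsKKTPoint f ψ u s) :
    IsUnit (borderedDiag fun i => d2 (f i) (u i)) := by
  have := nonempty_of_sum_eq_one hu.sum_eq_one
  exact isUnit_borderedDiag fun i =>
    (hf i).modulus_pos.trans_le ((hf i).modulus_le_d2 _ (hu.mem_intDom i))

lemma continuous_toEuclideanCLM {𝕜 : Type*} [RCLike 𝕜] [DecidableEq ι] :
    Continuous (toEuclideanCLM (n := ι) (𝕜 := 𝕜)) :=
  LinearMap.continuous_of_finiteDimensional
    (toEuclideanCLM (n := ι) (𝕜 := 𝕜)).toAlgEquiv.toLinearMap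

lemma hasFDerivAt_of_isKKTPoint [DecidableEq ι] (hf : ∀ i, IsFeeComponent (f i) η)
    (hw : ∀ ψ, IsKKTPoint f ψ (w ψ) (r ψ)) (ψ : EuclideanSpace ℝ ι) :
    HasFDerivAt w (toEuclideanCLM (𝕜 := ℝ) (condensedInv fun i => d2 (f i) (w ψ i))) ψ := by
  have hsame : (fun i => dslope (d1 (f i)) (w ψ i) (w ψ i)) = fun i => d2 (f i) (w ψ i) :=
    funext fun i => dslope_same _ _
  have hdslope : ContinuousAt (fun φ i => dslope (d1 (f i)) (w ψ i) (w φ i)) ψ := by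
    refine continuousAt_pi.2 fun i => ContinuousAt.comp' ?_
      ((PiLp.continuous_apply 2 _ i).comp (continuous_of_isKKTPoint hf hw)).continuousAt
    exact continuousAt_dslope_same.2 ((hf i).d1_differentiableOn.differentiableAt
      (isOpen_intDom.mem_nhds ((hw ψ).mem_intDom i)))
  have hcondensed := continuousAt_condensedInv (isUnit_borderedDiag_d2 hf (hw ψ))
  rw [← hsame] at hcondensed ⊢
  exact hasFDerivAt_of_sub_eq_apply_sub
    (L := fun φ =>
      toEuclideanCLM (𝕜 := ℝ) (condensedInv fun i => dslope (d1 (f i)) (w ψ i) (w φ i)))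
    (continuous_toEuclideanCLM.continuousAt.comp (hcondensed.comp' hdslope))
    fun φ => ((hw ψ).condensedInv_dslope_apply hf (hw φ)).symm

lemma contDiff_one_of_isKKTPoint (hf : ∀ i, IsFeeComponent (f i) η)
    (hw : ∀ ψ, IsKKTPoint f ψ (w ψ) (r ψ)) : ContDiff ℝ 1 w := by
  classical
  refine contDiff_one_iff_hasFDerivAt.2 ⟨_, ?_, hasFDerivAt_of_isKKTPoint hf hw⟩
  refine continuous_toEuclideanCLM.comp (continuous_iff_continuousAt.2 fun ψ => ?_)
  refine (continuousAt_condensedInv (isUnit_borderedDiag_d2 hf (hw ψ))).comp'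
    (f := fun φ i => d2 (f i) (w φ i)) (continuousAt_pi.2 fun i => ?_)
  refine ContinuousAt.comp' (g := d2 (f i)) ?_
    ((PiLp.continuous_apply 2 _ i).comp (continuous_of_isKKTPoint hf hw)).continuousAt
  exact (hf i).d2_locallyLipschitzOn.continuousOn.continuousAt
    (isOpen_intDom.mem_nhds ((hw ψ).mem_intDom i))

end Selection

section Existence

lemma exists_mem_intDom_sum_eq_one (hf : ∀ i, IsFeeComponent (f i) η)
    (hleft : ∑ i, leftEnd (f i) < 1) (hright : 1 < ∑ i, rightEnd (f i)) :
    ∃ v : ι → ℝ, (∀ i, v i ∈ intDom (f i)) ∧ ∑ i, v i = 1 := by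
  set a := ∑ i, leftEnd (f i)
  set b := ∑ i, rightEnd (f i)
  have hab : 0 < b - a := by linarith
  obtain ⟨t, ht, ht_pos, ht_lt⟩ : ∃ t, t * (b - a) = 1 - a ∧ 0 < t ∧ t < 1 :=
    ⟨(1 - a) / (b - a), div_mul_cancel₀ _ hab.ne', div_pos (by linarith) hab,
      (div_lt_one hab).2 (by linarith)⟩
  refine ⟨fun i => leftEnd (f i) + t * (rightEnd (f i) - leftEnd (f i)), fun i => ?_, ?_⟩
  · have hlength := sub_pos.2 (hf i).leftEnd_lt_rightEnd
    rw [(hf i).intDom_eq_Ioo]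
    exact ⟨by linarith [mul_pos ht_pos hlength], by linarith [mul_lt_of_lt_one_left hlength ht_lt]⟩
  · rw [Finset.sum_add_distrib, ← Finset.mul_sum, Finset.sum_sub_distrib]
    linarith

lemma exists_isKKTPoint (hf : ∀ i, IsFeeComponent (f i) η)
    (hleft : ∑ i, leftEnd (f i) < 1) (hright : 1 < ∑ i, rightEnd (f i))
    (ψ : EuclideanSpace ℝ ι) : ∃ w r, IsKKTPoint f ψ w r := by
  obtain ⟨v, hv, hv_sum⟩ := exists_mem_intDom_sum_eq_one hf hleft hright
  have hcont : Continuous fun r => ∑ i, slopeInv (f i) (ψ i - r) :=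
    continuous_finsetSum _ fun i _ =>
      (hf i).lipschitzWith_slopeInv.continuous.comp (continuous_const.sub continuous_id)
  obtain ⟨R, hR⟩ := Finite.bddAbove_range fun i => ψ i - d1 (f i) (v i)
  obtain ⟨r, hr⟩ := Finite.bddBelow_range fun i => ψ i - d1 (f i) (v i)
  have hR_le : ∑ i, slopeInv (f i) (ψ i - R) ≤ 1 := hv_sum ▸ Finset.sum_le_sum fun i _ => by
    rw [← (hf i).slopeInv_d1 (hv i)]
    exact (hf i).monotone_slopeInv (sub_le_comm.1 (hR (mem_range_self i)))
  have hr_ge : 1 ≤ ∑ i, slopeInv (f i) (ψ i - r) := hv_sum ▸ Finset.sum_le_sum fun i _ => by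
    conv_lhs => rw [← (hf i).slopeInv_d1 (hv i)]
    exact (hf i).monotone_slopeInv (le_sub_comm.1 (hr (mem_range_self i)))
  obtain ⟨s, hs⟩ := mem_range_of_exists_le_of_exists_ge hcont ⟨R, hR_le⟩ ⟨r, hr_ge⟩
  refine ⟨WithLp.toLp 2 fun i => slopeInv (f i) (ψ i - s), s, fun i => (hf i).slopeInv_mem _,
    fun i => ?_, hs⟩
  rw [(hf i).d1_slopeInv, sub_add_cancel]

end Existence

end KKT

section Conjugate

variable {N : ℕ} {F : EuclideanSpace ℝ (Fin N) → EReal}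

/-- `w` attains the supremum that defines the conjugate of `F` at `ψ`. -/
def IsConjugateArgmax (F : EuclideanSpace ℝ (Fin N) → EReal) (ψ w : EuclideanSpace ℝ (Fin N)) :
    Prop :=
  w ∈ effDom F ∧ IsMaxOn (fun v => inner ℝ v ψ - (F v).toReal) (effDom F) w

lemma IsConjugateArgmax.conjugate_eq {ψ w : EuclideanSpace ℝ (Fin N)} (hF : ∀ v, F v ≠ ⊥)
    (hw : IsConjugateArgmax F ψ w) :
    conjugate F ψ = ((inner ℝ w ψ - (F w).toReal : ℝ) : EReal) := by
  have term_eq {v : EuclideanSpace ℝ (Fin N)} (hv : v ∈ effDom F) :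
      ((inner ℝ v ψ : ℝ) : EReal) - F v = ((inner ℝ v ψ - (F v).toReal : ℝ) : EReal) := by
    rw [EReal.coe_sub, coe_toReal_of_mem_effDom (hF v) hv]
  refine le_antisymm (iSup_le fun v => ?_) ?_
  · by_cases hv : v ∈ effDom F
    · rw [term_eq hv]
      exact EReal.coe_le_coe_iff.2 (hw.2 hv)
    · rw [show F v = ⊤ from not_lt_top_iff.1 hv, EReal.sub_top]
      exact bot_le
  · rw [← term_eq hw.1]
    exact le_iSup (fun v => ((inner ℝ v ψ : ℝ) : EReal) - F v) w

variable {p : EuclideanSpace ℝ (Fin N) → EuclideanSpace ℝ (Fin N)}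

lemma hasGradientAt_conjugateReal (hF : ∀ v, F v ≠ ⊥) (hp : ∀ ψ, IsConjugateArgmax F ψ (p ψ))
    (hcont : Continuous p) (ψ : EuclideanSpace ℝ (Fin N)) :
    HasGradientAt (conjugateReal F) (p ψ) ψ := by
  have value (φ) : conjugateReal F φ = inner ℝ (p φ) φ - (F (p φ)).toReal := by
    rw [conjugateReal, (hp φ).conjugate_eq hF, EReal.toReal_coe]
  refine hasGradientAt_of_subgradient hcont.continuousAt fun φ φ' => ?_
  have hmax : inner ℝ (p φ) φ' - (F (p φ)).toReal ≤ inner ℝ (p φ') φ' - (F (p φ')).toReal :=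
    (hp φ').2 (hp φ).1
  rw [value, value, inner_sub_right]
  linarith

lemma isConjugateArgmax_of_effDom_eq_singleton {w : EuclideanSpace ℝ (Fin N)}
    (hw : effDom F = {w}) (ψ : EuclideanSpace ℝ (Fin N)) : IsConjugateArgmax F ψ w := by
  refine ⟨hw ▸ mem_singleton w, fun v hv => ?_⟩
  rw [hw, mem_singleton_iff] at hv
  simp only [hv, mem_ofPred_eq, le_refl]

lemma hessian_conjugateReal_of_effDom_eq_singleton {w : EuclideanSpace ℝ (Fin N)}
    (hF : ∀ v, F v ≠ ⊥) (hw : effDom F = {w}) (ψ : EuclideanSpace ℝ (Fin N)) :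
    hessian (conjugateReal F) ψ = 0 := by
  rw [hessian_eq_transpose (A := 0) (hasGradientAt_conjugateReal hF
    (isConjugateArgmax_of_effDom_eq_singleton hw) continuous_const) ?_, Matrix.transpose_zero]
  rw [map_zero]
  exact hasFDerivAt_const w ψ

end Conjugate

section SplitFee

/-- The storage fee that splits into the functions `f i`: `∑ i, f i (w i)` on the simplex and `+∞`
off it. -/
noncomputable def splitFee {N : ℕ} (f : Fin N → ℝ → EReal) (w : EuclideanSpace ℝ (Fin N)) : EReal :=
  ∑ i, f i (w i) + indicatorFn (weightSet N) w

lemma ereal_sum_ne_bot {ι : Type*} {s : Finset ι} {g : ι → EReal} (hg : ∀ i ∈ s, g i ≠ ⊥) :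
    ∑ i ∈ s, g i ≠ ⊥ :=
  Finset.sum_induction g (· ≠ ⊥) (fun _ _ ha hb => EReal.add_ne_bot_iff.2 ⟨ha, hb⟩)
    EReal.zero_ne_bot hg

lemma ereal_sum_lt_top_iff {ι : Type*} {s : Finset ι} {g : ι → EReal} (hg : ∀ i ∈ s, g i ≠ ⊥) :
    ∑ i ∈ s, g i < ⊤ ↔ ∀ i ∈ s, g i < ⊤ := by
  classical
  constructor
  · intro hsum i hi
    rw [← Finset.add_sum_erase s g hi, lt_top_iff_ne_top, EReal.add_ne_top_iff_ne_top₂ (hg i hi)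
      (ereal_sum_ne_bot fun j hj => hg j (Finset.mem_of_mem_erase hj))] at hsum
    exact lt_top_iff_ne_top.2 hsum.1
  · exact Finset.sum_induction g (· < ⊤) (fun _ _ ha hb => EReal.add_lt_top ha.ne hb.ne)
      EReal.zero_lt_top

lemma ereal_coe_sum {ι : Type*} (s : Finset ι) (g : ι → ℝ) :
    ((∑ i ∈ s, g i : ℝ) : EReal) = ∑ i ∈ s, (g i : EReal) :=
  map_sum (⟨⟨Real.toEReal, EReal.coe_zero⟩, EReal.coe_add⟩ : ℝ →+ EReal) g s

variable {N : ℕ} {f : Fin N → ℝ → EReal} {η : ℝ}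

lemma splitFee_ne_bot (hbot : ∀ i x, f i x ≠ ⊥) (w : EuclideanSpace ℝ (Fin N)) :
    splitFee f w ≠ ⊥ := by
  refine EReal.add_ne_bot_iff.2 ⟨ereal_sum_ne_bot fun i _ => hbot i _, ?_⟩
  rw [indicatorFn]
  split_ifs <;> simp

lemma mem_effDom_splitFee_iff (hbot : ∀ i x, f i x ≠ ⊥) {w : EuclideanSpace ℝ (Fin N)} :
    w ∈ effDom (splitFee f) ↔ w ∈ weightSet N ∧ ∀ i, w i ∈ effDom (f i) := by
  have hsum_bot : ∑ i, f i (w i) ≠ ⊥ := ereal_sum_ne_bot fun i _ => hbot i _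
  change splitFee f w < ⊤ ↔ _
  by_cases hw : w ∈ weightSet N
  · rw [splitFee, indicatorFn, if_pos hw, add_zero, ereal_sum_lt_top_iff fun i _ => hbot i _]
    simp only [hw, Finset.mem_univ, true_imp_iff, true_and]
    rfl
  · rw [splitFee, indicatorFn, if_neg hw, EReal.add_top_of_ne_bot hsum_bot]
    simp only [hw, lt_irrefl, false_and]

lemma toReal_splitFee (hbot : ∀ i x, f i x ≠ ⊥) {w : EuclideanSpace ℝ (Fin N)}
    (hw : w ∈ effDom (splitFee f)) : (splitFee f w).toReal = ∑ i, (f i (w i)).toReal := by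
  obtain ⟨hw_simplex, hw_dom⟩ := (mem_effDom_splitFee_iff hbot).1 hw
  have value : splitFee f w = ((∑ i, (f i (w i)).toReal : ℝ) : EReal) := by
    rw [splitFee, indicatorFn, if_pos hw_simplex, add_zero, ereal_coe_sum]
    exact Finset.sum_congr rfl fun i _ => (coe_toReal_of_mem_effDom (hbot i _) (hw_dom i)).symm
  rw [value, EReal.toReal_coe]

lemma lt_of_strictMono_of_le_of_le {α β : Type*} [PartialOrder α] [PartialOrder β] {g : α → β}
    (hg : StrictMono g) {l u v : α} (hu : l ≤ u) (hv : l ≤ v) (hne : u ≠ v) (huv : g u = g v) :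
    g l < g u := by
  rcases hu.lt_or_eq with hlt | rfl
  · exact hg hlt
  · exact absurd huv (hg (lt_of_le_of_ne hv hne)).ne

lemma sum_leftEnd_lt_one_lt_sum_rightEnd (hf : ∀ i, IsFeeComponent (f i) η)
    (hdom : (effDom (splitFee f)).Nontrivial) :
    ∑ i, leftEnd (f i) < 1 ∧ 1 < ∑ i, rightEnd (f i) := by
  obtain ⟨u, hu, v, hv, huv⟩ := hdom
  rw [mem_effDom_splitFee_iff fun i => (hf i).proper.1] at hu hv
  have hne : u.ofLp ≠ v.ofLp := (WithLp.ofLp_injective 2).ne huv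
  have hsum : ∑ i, u i = ∑ i, v i := hu.1.1.trans hv.1.1.symm
  have hmono : StrictMono fun w : Fin N → ℝ => ∑ i, w i := Fintype.sum_strictMono
  have left_le {w : Fin N → ℝ} (hw : ∀ i, w i ∈ effDom (f i)) : (fun i => leftEnd (f i)) ≤ w :=
    fun i => csInf_le (hf i).bddBelow_effDom (hw i)
  have le_right {w : Fin N → ℝ} (hw : ∀ i, w i ∈ effDom (f i)) : w ≤ fun i => rightEnd (f i) :=
    fun i => le_csSup (hf i).bddAbove_effDom (hw i)
  rw [← hu.1.1]
  exact ⟨lt_of_strictMono_of_le_of_le hmono (left_le hu.2) (left_le hv.2) hne hsum,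
    lt_of_strictMono_of_le_of_le hmono.dual (le_right hu.2) (le_right hv.2) hne hsum⟩

lemma IsKKTPoint.isConjugateArgmax (hf : ∀ i, IsFeeComponent (f i) η)
    {ψ w : EuclideanSpace ℝ (Fin N)} {r : ℝ} (hw : IsKKTPoint f ψ w r) :
    IsConjugateArgmax (splitFee f) ψ w := by
  have hbot (i) := (hf i).proper.1
  have hw_dom (i) : w i ∈ effDom (f i) := intDom_subset_effDom (hw.mem_intDom i)
  have hmem : w ∈ effDom (splitFee f) := (mem_effDom_splitFee_iff hbot).2
    ⟨⟨hw.sum_eq_one, fun i => (hf i).effDom_subset_Ici (hw_dom i)⟩, hw_dom⟩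
  refine ⟨hmem, fun v hv => ?_⟩
  obtain ⟨⟨hv_sum, -⟩, hv_dom⟩ := (mem_effDom_splitFee_iff hbot).1 hv
  have tangent : ∑ i, ((f i (w i)).toReal + (ψ i - r) * (v i - w i)) ≤ ∑ i, (f i (v i)).toReal :=
    Finset.sum_le_sum fun i _ => by
      rw [← eq_sub_of_add_eq (hw.d1_add i)]
      exact (hf i).add_d1_mul_sub_le (hw.mem_intDom i) (hv_dom i)
  have expand : ∑ i, (ψ i - r) * (v i - w i) = inner ℝ v ψ - inner ℝ w ψ := by
    have hvw_sum : ∑ i, (v i - w i) = 0 := by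
      rw [Finset.sum_sub_distrib, hv_sum, hw.sum_eq_one, sub_self]
    simp only [sub_mul (ψ _), Finset.sum_sub_distrib, ← Finset.mul_sum, hvw_sum, mul_zero, sub_zero]
    rw [← inner_sub_left]
    simp [PiLp.inner_apply]
  rw [Finset.sum_add_distrib, expand] at tangent
  simp only [mem_ofPred_eq, toReal_splitFee hbot hmem, toReal_splitFee hbot hv]
  linarith

end SplitFee

section BoundedOscillation

variable {N : ℕ} {f : Fin N → ℝ → EReal} {η : ℝ}

/-- The `ψ` whose coordinates differ by at most `K`. For `K = 2 ‖c‖_∞` this set contains `𝒦⁰`, and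
the Lipschitz estimate holds on all of it. -/
def boundedOscillation (N : ℕ) (K : ℝ) : Set (EuclideanSpace ℝ (Fin N)) :=
  {ψ | ∀ i k, ψ i - ψ k ≤ K}

lemma neg_d1_add_le_slopeBound (M : ℝ) {k : Fin N}
    (hk : leftEnd (f k) + marginA f ∈ intDom (f k)) :
    -d1 (f k) (leftEnd (f k) + marginA f) + 2 * M ≤ slopeBound f M := by
  refine add_le_add_left (le_max_of_le_right (le_max_of_le_left ?_)) _
  exact le_ciSup_of_le (Set.finite_range _).bddAbove k (if_pos hk).ge

lemma d1_add_le_slopeBound (M : ℝ) {k : Fin N}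
    (hk : rightEnd (f k) - marginB f ∈ intDom (f k)) :
    d1 (f k) (rightEnd (f k) - marginB f) + 2 * M ≤ slopeBound f M := by
  refine add_le_add_left (le_max_of_le_right (le_max_of_le_right ?_)) _
  exact le_ciSup_of_le (Set.finite_range _).bddAbove k (if_pos hk).ge

lemma sum_leftEnd_add_marginA [NeZero N] (f : Fin N → ℝ → EReal) :
    ∑ i, (leftEnd (f i) + marginA f) = 1 := by
  rw [Finset.sum_add_distrib, Finset.sum_const, Finset.card_univ, Fintype.card_fin, nsmul_eq_mul,
    marginA, mul_div_cancel₀ _ (NeZero.ne (N : ℝ)), add_sub_cancel]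

lemma sum_rightEnd_sub_marginB [NeZero N] (f : Fin N → ℝ → EReal) :
    ∑ i, (rightEnd (f i) - marginB f) = 1 := by
  rw [Finset.sum_sub_distrib, Finset.sum_const, Finset.card_univ, Fintype.card_fin, nsmul_eq_mul,
    marginB, mul_div_cancel₀ _ (NeZero.ne (N : ℝ)), sub_sub_cancel]

namespace IsKKTPoint

variable {M r : ℝ} {ψ w : EuclideanSpace ℝ (Fin N)}

lemma mem_Ioo_ends (hf : ∀ i, IsFeeComponent (f i) η) (hw : IsKKTPoint f ψ w r) (i : Fin N) :
    w i ∈ Ioo (leftEnd (f i)) (rightEnd (f i)) :=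
  (hf i).intDom_eq_Ioo ▸ hw.mem_intDom i

lemma marginA_pos (hf : ∀ i, IsFeeComponent (f i) η) (hw : IsKKTPoint f ψ w r) :
    0 < marginA f := by
  have := nonempty_of_sum_eq_one hw.sum_eq_one
  have hN : (0 : ℝ) < N := Nat.cast_pos.2 (Fin.pos_iff_nonempty.2 this)
  refine div_pos (sub_pos.2 ?_) hN
  rw [← hw.sum_eq_one]
  exact Finset.sum_lt_sum_of_nonempty Finset.univ_nonempty fun i _ => (hw.mem_Ioo_ends hf i).1

lemma marginB_pos (hf : ∀ i, IsFeeComponent (f i) η) (hw : IsKKTPoint f ψ w r) :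
    0 < marginB f := by
  have := nonempty_of_sum_eq_one hw.sum_eq_one
  have hN : (0 : ℝ) < N := Nat.cast_pos.2 (Fin.pos_iff_nonempty.2 this)
  refine div_pos (sub_pos.2 ?_) hN
  rw [← hw.sum_eq_one]
  exact Finset.sum_lt_sum_of_nonempty Finset.univ_nonempty fun i _ => (hw.mem_Ioo_ends hf i).2

lemma d1_sub_d1_le (hw : IsKKTPoint f ψ w r) (hψ : ψ ∈ boundedOscillation N (2 * M))
    (i k : Fin N) : d1 (f i) (w i) - d1 (f k) (w k) ≤ 2 * M := by
  linarith [hψ i k, hw.d1_add i, hw.d1_add k]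

-- Since `∑ k, (a k + A) = ∑ k, w k`, some `k` has `w k ≥ a k + A`, and `d1 (f k)` increases.
lemma neg_d1_le_slopeBound (hf : ∀ i, IsFeeComponent (f i) η) (hw : IsKKTPoint f ψ w r)
    (hψ : ψ ∈ boundedOscillation N (2 * M)) (i : Fin N) :
    -d1 (f i) (w i) ≤ slopeBound f M := by
  have : NeZero N := ⟨i.pos.ne'⟩
  obtain ⟨k, -, hk⟩ := Finset.exists_le_of_sum_le Finset.univ_nonempty
    ((sum_leftEnd_add_marginA f).trans hw.sum_eq_one.symm).le
  have hmem : leftEnd (f k) + marginA f ∈ intDom (f k) := by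
    rw [(hf k).intDom_eq_Ioo]
    exact ⟨lt_add_of_pos_right _ (hw.marginA_pos hf), hk.trans_lt (hw.mem_Ioo_ends hf k).2⟩
  have hd1 := (hf k).strictMonoOn_d1.monotoneOn hmem (hw.mem_intDom k) hk
  linarith [hw.d1_sub_d1_le hψ k i, neg_d1_add_le_slopeBound M hmem]

lemma d1_le_slopeBound (hf : ∀ i, IsFeeComponent (f i) η) (hw : IsKKTPoint f ψ w r)
    (hψ : ψ ∈ boundedOscillation N (2 * M)) (i : Fin N) : d1 (f i) (w i) ≤ slopeBound f M := by
  have : NeZero N := ⟨i.pos.ne'⟩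
  obtain ⟨k, -, hk⟩ := Finset.exists_le_of_sum_le Finset.univ_nonempty
    (hw.sum_eq_one.trans (sum_rightEnd_sub_marginB f).symm).le
  have hmem : rightEnd (f k) - marginB f ∈ intDom (f k) := by
    rw [(hf k).intDom_eq_Ioo]
    exact ⟨(hw.mem_Ioo_ends hf k).1.trans_le hk, sub_lt_self _ (hw.marginB_pos hf)⟩
  have hd1 := (hf k).strictMonoOn_d1.monotoneOn (hw.mem_intDom k) hmem hk
  linarith [hw.d1_sub_d1_le hψ i k, d1_add_le_slopeBound M hmem]

lemma mem_slopeSet (hf : ∀ i, IsFeeComponent (f i) η) (hw : IsKKTPoint f ψ w r)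
    (hψ : ψ ∈ boundedOscillation N (2 * M)) (i : Fin N) : w i ∈ slopeSet f M i :=
  ⟨hw.mem_intDom i, abs_le'.2 ⟨hw.d1_le_slopeBound hf hψ i, hw.neg_d1_le_slopeBound hf hψ i⟩⟩

end IsKKTPoint

lemma norm_d2_sub_le (hf : ∀ i, IsFeeComponent (f i) η) {M : ℝ} {w w' : EuclideanSpace ℝ (Fin N)}
    (hw : ∀ i, w i ∈ slopeSet f M i) (hw' : ∀ i, w' i ∈ slopeSet f M i) :
    ‖WithLp.toLp 2 ((fun i => d2 (f i) (w i)) - fun i => d2 (f i) (w' i))‖ ≤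
      lipConst f M * ‖w - w'‖ := by
  have hL := lipConst_nonneg f M
  rw [← sq_le_sq₀ (norm_nonneg _) (by positivity), mul_pow, EuclideanSpace.real_norm_sq_eq,
    EuclideanSpace.real_norm_sq_eq, Finset.mul_sum]
  refine Finset.sum_le_sum fun i _ => ?_
  rw [← mul_pow, sq_le_sq, abs_mul, abs_of_nonneg hL]
  exact abs_d2_sub_le (hf i) (hw i) (hw' i)

end BoundedOscillation

section Hessian

variable {N : ℕ} {f : Fin N → ℝ → EReal} {η : ℝ}

lemma exists_contDiff_isConjugateArgmax (hf : ∀ i, IsFeeComponent (f i) η)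
    (hne : (effDom (splitFee f)).Nonempty) :
    ∃ p : EuclideanSpace ℝ (Fin N) → EuclideanSpace ℝ (Fin N), ContDiff ℝ 1 p ∧
      (∀ ψ, IsConjugateArgmax (splitFee f) ψ (p ψ)) ∧
      ((effDom (splitFee f)).Nontrivial →
        ∃ r : EuclideanSpace ℝ (Fin N) → ℝ, ∀ ψ, IsKKTPoint f ψ (p ψ) (r ψ)) := by
  rcases (effDom (splitFee f)).subsingleton_or_nontrivial with hsub | hdom
  · obtain ⟨w, hw⟩ := hsub.eq_empty_or_singleton.resolve_left hne.ne_empty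
    exact ⟨fun _ => w, contDiff_const, isConjugateArgmax_of_effDom_eq_singleton hw,
      fun h => absurd h hsub.not_nontrivial⟩
  · obtain ⟨hleft, hright⟩ := sum_leftEnd_lt_one_lt_sum_rightEnd hf hdom
    choose p r hp using exists_isKKTPoint hf hleft hright
    exact ⟨p, contDiff_one_of_isKKTPoint hf hp, fun ψ => (hp ψ).isConjugateArgmax hf,
      fun _ => ⟨r, hp⟩⟩

lemma hessian_conjugateReal_of_isKKTPoint (hf : ∀ i, IsFeeComponent (f i) η)
    {w : EuclideanSpace ℝ (Fin N) → EuclideanSpace ℝ (Fin N)} {r : EuclideanSpace ℝ (Fin N) → ℝ}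
    (hw : ∀ ψ, IsKKTPoint f ψ (w ψ) (r ψ)) (ψ : EuclideanSpace ℝ (Fin N)) :
    hessian (conjugateReal (splitFee f)) ψ = condensedInv fun i => d2 (f i) (w ψ i) :=
  (hessian_eq_transpose (hasGradientAt_conjugateReal (splitFee_ne_bot fun i => (hf i).proper.1)
    (fun φ => (hw φ).isConjugateArgmax hf) (continuous_of_isKKTPoint hf hw))
    (hasFDerivAt_of_isKKTPoint hf hw ψ)).trans (isSymm_condensedInv _)

lemma frobNorm_hessian_sub_le_of_isKKTPoint (hη : 0 < η) (hf : ∀ i, IsFeeComponent (f i) η)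
    {w : EuclideanSpace ℝ (Fin N) → EuclideanSpace ℝ (Fin N)} {r : EuclideanSpace ℝ (Fin N) → ℝ}
    (hw : ∀ ψ, IsKKTPoint f ψ (w ψ) (r ψ)) {M : ℝ} {ψ₁ ψ₂ : EuclideanSpace ℝ (Fin N)}
    (hψ₁ : ψ₁ ∈ boundedOscillation N (2 * M)) (hψ₂ : ψ₂ ∈ boundedOscillation N (2 * M)) :
    frobNorm (hessian (conjugateReal (splitFee f)) ψ₁ - hessian (conjugateReal (splitFee f)) ψ₂) ≤
      lipConst f M * η⁻¹ ^ 3 * ‖ψ₁ - ψ₂‖ := by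
  have hL := lipConst_nonneg f M
  have modulus_le (ψ) (i) : η ≤ d2 (f i) (w ψ i) := (hf i).modulus_le_d2 _ ((hw ψ).mem_intDom i)
  rw [hessian_conjugateReal_of_isKKTPoint hf hw, hessian_conjugateReal_of_isKKTPoint hf hw]
  calc _ ≤ η⁻¹ ^ 2 * ‖WithLp.toLp 2
        ((fun i => d2 (f i) (w ψ₁ i)) - fun i => d2 (f i) (w ψ₂ i))‖ :=
      frobNorm_condensedInv_sub_le hη (modulus_le ψ₁) (modulus_le ψ₂)
    _ ≤ η⁻¹ ^ 2 * (lipConst f M * ‖w ψ₁ - w ψ₂‖) := by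
      gcongr
      exact norm_d2_sub_le hf ((hw ψ₁).mem_slopeSet hf hψ₁) ((hw ψ₂).mem_slopeSet hf hψ₂)
    _ ≤ η⁻¹ ^ 2 * (lipConst f M * (η⁻¹ * ‖ψ₁ - ψ₂‖)) := by
      gcongr
      exact (hw ψ₂).norm_sub_le hf (hw ψ₁)
    _ = lipConst f M * η⁻¹ ^ 3 * ‖ψ₁ - ψ₂‖ := by ring

lemma frobNorm_hessian_sub_le (hf : ∀ i, IsFeeComponent (f i) η)
    (hne : (effDom (splitFee f)).Nonempty) {M : ℝ} {ψ₁ ψ₂ : EuclideanSpace ℝ (Fin N)}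
    (hψ₁ : ψ₁ ∈ boundedOscillation N (2 * M)) (hψ₂ : ψ₂ ∈ boundedOscillation N (2 * M)) :
    frobNorm (hessian (conjugateReal (splitFee f)) ψ₁ - hessian (conjugateReal (splitFee f)) ψ₂) ≤
      lipConst f M * η⁻¹ ^ 3 * ‖ψ₁ - ψ₂‖ := by
  have hbot (i) := (hf i).proper.1
  obtain ⟨w, hw⟩ := hne
  have hη : 0 < η :=
    (hf (nonempty_of_sum_eq_one ((mem_effDom_splitFee_iff hbot).1 hw).1.1).some).modulus_pos
  rcases (effDom (splitFee f)).subsingleton_or_nontrivial with hsub | hdom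
  · have hL := lipConst_nonneg f M
    have hzero : frobNorm (0 : Matrix (Fin N) (Fin N) ℝ) = 0 := by simp [frobNorm]
    have hhessian := hessian_conjugateReal_of_effDom_eq_singleton (splitFee_ne_bot hbot)
      (hsub.eq_singleton_of_mem hw)
    rw [hhessian, hhessian, sub_self, hzero]
    positivity
  · obtain ⟨hleft, hright⟩ := sum_leftEnd_lt_one_lt_sum_rightEnd hf hdom
    choose p r hp using exists_isKKTPoint hf hleft hright
    exact frobNorm_hessian_sub_le_of_isKKTPoint hη hf hp hψ₁ hψ₂

end Hessian

section Cost

variable {n N : ℕ} {X : Set (EuclideanSpace ℝ (Fin n))}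
  {c : EuclideanSpace ℝ (Fin n) → EuclideanSpace ℝ (Fin n) → ℝ}
  {y : Fin N → EuclideanSpace ℝ (Fin n)}

lemma abs_cost_le_costSup (hX : IsCompact X) (hc : ∀ i, ContinuousOn (fun x => c x (y i)) X)
    {x : EuclideanSpace ℝ (Fin n)} (hx : x ∈ X) (i : Fin N) : |c x (y i)| ≤ costSup X c y := by
  choose K hK using fun i => hX.exists_bound_of_continuousOn (hc i)
  obtain ⟨L, hL⟩ := Finite.bddAbove_range K
  refine le_ciSup (f := fun p : X × Fin N => |c p.1 (y p.2)|) ⟨L, ?_⟩ (⟨x, hx⟩, i)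
  rintro _ ⟨p, rfl⟩
  exact (hK p.2 p.1 p.1.2).trans (hL (mem_range_self _))

lemma massSet_zero_subset_boundedOscillation (hX : IsCompact X)
    (μ : MeasureTheory.Measure (EuclideanSpace ℝ (Fin n)))
    (hc : ∀ i, ContinuousOn (fun x => c x (y i)) X) :
    massSet X μ c y 0 ⊆ boundedOscillation N (2 * costSup X c y) := by
  intro ψ hψ i k
  obtain ⟨x, hx, hxk⟩ : (laguerreCell X c y ψ i).Nonempty := by
    rw [nonempty_iff_ne_empty]
    exact fun hempty => (hψ i).ne' (by rw [hempty, MeasureTheory.measureReal_empty])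
  have hi := (abs_le.1 (abs_cost_le_costSup hX hc hx i)).1
  have hk := (abs_le.1 (abs_cost_le_costSup hX hc hx k)).2
  linarith [hxk k]

end Cost

lemma norm_le_four_mul_sq_mul_norm {N : ℕ} (v : EuclideanSpace ℝ (Fin N)) :
    ‖v‖ ≤ 4 * (N : ℝ) ^ 2 * ‖v‖ := by
  rcases N.eq_zero_or_pos with rfl | hN
  · simp [Subsingleton.elim v 0]
  · have hN_one : (1 : ℝ) ≤ N := Nat.one_le_cast.2 hN
    exact le_mul_of_one_le_left (norm_nonneg v) (by nlinarith)

end SemiDiscrete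

theorem mainTheorem5_general {N : ℕ} {f : Fin N → ℝ → EReal} {η : ℝ}
    (hf : ∀ i, IsFeeComponent (f i) η) (hne : (effDom (splitFee f)).Nonempty) (M : ℝ) :
    (∀ ψ, ((conjugateReal (splitFee f) ψ : ℝ) : EReal) = conjugate (splitFee f) ψ) ∧
    ContDiff ℝ 2 (conjugateReal (splitFee f)) ∧
    IsC21On (conjugateReal (splitFee f)) (boundedOscillation N (2 * M)) ∧
    ((effDom (splitFee f)).Nontrivial → ∀ ψ,
      (∀ i, gradient (conjugateReal (splitFee f)) ψ i ∈ intDom (f i)) ∧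
      IsUnit (borderedJacobian f (gradient (conjugateReal (splitFee f)) ψ)) ∧
      hessian (conjugateReal (splitFee f)) ψ =
        ((borderedJacobian f (gradient (conjugateReal (splitFee f)) ψ))⁻¹).toBlocks₁₁) ∧
    (∀ i, IsCompact (slopeSet f M i) ∧ slopeSet f M i ⊆ intDom (f i) ∧
      BddAbove (quotientSet f M i)) ∧
    ∀ ψ₁ ∈ boundedOscillation N (2 * M), ∀ ψ₂ ∈ boundedOscillation N (2 * M),
      frobNorm (hessian (conjugateReal (splitFee f)) ψ₁ - hessian (conjugateReal (splitFee f)) ψ₂) ≤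
        lipConst f M * η⁻¹ ^ 3 * ‖ψ₁ - ψ₂‖ := by
  have hbot : ∀ w, splitFee f w ≠ ⊥ := splitFee_ne_bot fun i => (hf i).proper.1
  obtain ⟨p, hp, hargmax, hkkt⟩ := exists_contDiff_isConjugateArgmax hf hne
  have hgrad := hasGradientAt_conjugateReal hbot hargmax hp.continuous
  have hC2 := contDiff_two_of_hasGradientAt hgrad hp
  have hlip : ∀ ψ₁ ∈ boundedOscillation N (2 * M), ∀ ψ₂ ∈ boundedOscillation N (2 * M), _ :=
    fun _ hψ₁ _ hψ₂ => frobNorm_hessian_sub_le hf hne hψ₁ hψ₂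
  refine ⟨fun ψ => ?_, hC2, isC21On_of_frobNorm_hessian_sub_le hC2 hlip, fun hdom ψ => ?_,
    fun i => ⟨(hf i).isCompact_setOf_abs_d1_le _, fun _ hx => hx.1, bddAbove_quotientSet (hf i)⟩,
    hlip⟩
  · rw [conjugateReal, (hargmax ψ).conjugate_eq hbot, EReal.toReal_coe]
  · obtain ⟨r, hr⟩ := hkkt hdom
    rw [(hgrad ψ).gradient]
    exact ⟨(hr ψ).mem_intDom, isUnit_borderedDiag_d2 hf (hr ψ),
      hessian_conjugateReal_of_isKKTPoint hf hr ψ⟩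

theorem mainTheorem5 {n N : ℕ}
    -- the source: a compact set `X` and a probability measure `μ` on it
    (X : Set (EuclideanSpace ℝ (Fin n))) (hX : IsCompact X)
    (μ : MeasureTheory.Measure (EuclideanSpace ℝ (Fin n)))
    [MeasureTheory.IsProbabilityMeasure μ] (hμ : μ Xᶜ = 0)
    -- the target points and the cost
    (y : Fin N → EuclideanSpace ℝ (Fin n))
    (c : EuclideanSpace ℝ (Fin n) → EuclideanSpace ℝ (Fin n) → ℝ)
    (hc : ∀ i, ContinuousOn (fun x => c x (y i)) X)
    -- the storage fee function
    (F : EuclideanSpace ℝ (Fin N) → EReal) (hF : IsStorageFee F)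
    (f : Fin N → ℝ → EReal) (hsplit : SplitsInto F f)
    (hsmooth : ∀ i, IsEssentiallySmooth (f i))
    (htwice : ∀ i, DifferentiableOn ℝ (d1 (f i)) (intDom (f i)))
    (hlip : ∀ i, LocallyLipschitzOn (intDom (f i)) (d2 (f i)))
    (η : ℝ) (hη : 0 < η) (hstrong : ∀ i, ∀ x ∈ intDom (f i), η ≤ d2 (f i) x) :
    -- `F*` is finite everywhere
    (∀ ψ, ((conjugateReal F ψ : ℝ) : EReal) = conjugate F ψ) ∧
    -- `F*` is `C²` on the whole space and `C^{2,1}` on `K⁰`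
    ContDiff ℝ 2 (conjugateReal F) ∧
    IsC21On (conjugateReal F) (massSet X μ c y 0) ∧
    -- the formula for the Hessian, unless the domain of `F` is a single point
    ((effDom F).Nontrivial → ∀ ψ,
      (∀ i, gradient (conjugateReal F) ψ i ∈ intDom (f i)) ∧
      IsUnit (borderedJacobian f (gradient (conjugateReal F) ψ)) ∧
      hessian (conjugateReal F) ψ =
        ((borderedJacobian f (gradient (conjugateReal F) ψ))⁻¹).toBlocks₁₁) ∧
    -- the sets `S_i` are compact in the interior of the domains, and `C_f` is finite
    (∀ i, IsCompact (slopeSet f (costSup X c y) i) ∧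
      slopeSet f (costSup X c y) i ⊆ intDom (f i) ∧
      BddAbove (quotientSet f (costSup X c y) i)) ∧
    -- the Lipschitz estimate
    ∀ ψ₁ ∈ massSet X μ c y 0, ∀ ψ₂ ∈ massSet X μ c y 0,
      frobNorm (hessian (conjugateReal F) ψ₁ - hessian (conjugateReal F) ψ₂) ≤
        4 * (N : ℝ) ^ 2 * lipConst f (costSup X c y) * η⁻¹ ^ 3 * ‖ψ₁ - ψ₂‖ := by
  obtain rfl : F = splitFee f := funext hsplit.2
  have hcomponent (i) : IsFeeComponent (f i) η :=
    ⟨(hsplit.1 i).1.proper, (hsplit.1 i).1.convex, (hsplit.1 i).2.trans Set.Icc_subset_Ici_self,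
      bddAbove_Icc.mono (hsplit.1 i).2, hsmooth i, htwice i, hlip i, hη, hstrong i⟩
  have hK := massSet_zero_subset_boundedOscillation hX μ hc
  obtain ⟨hfinite, hC2, hC21, hhessian, hslope, hestimate⟩ :=
    mainTheorem5_general hcomponent hF.1.proper.2 (costSup X c y)
  refine ⟨hfinite, hC2, hC21.mono hK, hhessian, hslope, fun ψ₁ hψ₁ ψ₂ hψ₂ => ?_⟩
  have hL := lipConst_nonneg f (costSup X c y)
  calc _ ≤ lipConst f (costSup X c y) * η⁻¹ ^ 3 * ‖ψ₁ - ψ₂‖ :=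
      hestimate ψ₁ (hK hψ₁) ψ₂ (hK hψ₂)
    _ ≤ lipConst f (costSup X c y) * η⁻¹ ^ 3 * (4 * (N : ℝ) ^ 2 * ‖ψ₁ - ψ₂‖) := by
      gcongr
      exact norm_le_four_mul_sq_mul_norm _
    _ = 4 * (N : ℝ) ^ 2 * lipConst f (costSup X c y) * η⁻¹ ^ 3 * ‖ψ₁ - ψ₂‖ := by ring
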